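/- **Theorem 4.1.** Let $L$ be a countable relational language and let $\mathcal K$ be a Fraïssé class of finite $L$-structures, i.e. a class of finite $L$-structures with countably many isomorphism types that is hereditary, has joint embedding and amalgamation, and contains structures of size at least $n$ for every $n\in\mathbb N$. Let $F$ be the Fraïssé limit of $\mathcal K$ and let $G_{\mathcal K}=\mathrm{Aut}(F)$, with the topology in which the pointwise stabilizers of finite subsets of $F$ form a neighbourhood basis at the identity. Suppose that $\mathcal K$ is Ramsey, that is, $\mathcal K$ has Ramsey degree $1$: for all $A,B\in\mathcal K$ and all $k\ge 2$ there is $C\in\mathcal K$ such that for every colouring with $k$ colours of the substructures of $C$ isomorphic to $A$ there is a substructure $B'\cong B$ of $C$ all of whose substructures isomorphic to $A$ have the same colour. Let $M(G_{\mathcal K})$ be the universal minimal $G_{\mathcal K}$-flow, i.e. the (up to isomorphism unique) nonempty compact Hausdorff space with a continuous action of $G_{\mathcal K}$ all of whose orbits are dense that admits a continuous $G_{\mathcal K}$-equivariant map into every other such flow. If $G_{\mathcal K}$ is amenable, i.e. there is a $G_{\mathcal K}$-invariant Borel probability measure on $M(G_{\mathcal K})$, then $G_{\mathcal K}$ is uniquely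 ergodic, i.e. there is exactly one $G_{\mathcal K}$-invariant Borel probability measure $\mu$ on $M(G_{\mathcal K})$. Moreover, $M(G_{\mathcal K})$ has exactly one orbit $O$ that is a dense $G_\delta$ set, and $\mu(O)=1$. -/

import Mathlib

open scoped FirstOrder
open CategoryTheory MeasureTheory

universe u v w

/-! ### Fraïssé classes -/

/-- A Fraïssé class of finite structures: Mathlib's `IsFraisse` (nonempty, countably many isomorphism
types, hereditary, joint embedding, amalgamation), all members finite, with members of size at least
`n` for every `n`. -/
structure IsFraisseClass {L : FirstOrder.Language.{u, v}}
    (K : Set (Bundled.{w} L.Structure)) : Prop where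
  isFraisse : FirstOrder.Language.IsFraisse K
  finite : ∀ A ∈ K, Finite A
  unbounded : ∀ n : ℕ, ∃ A ∈ K, n ≤ Nat.card A

/-! ### Ramsey degrees -/

/-- The set of substructures of `B` that are isomorphic to `A`. -/
def copies (L : FirstOrder.Language.{u, v}) (A B : Type w) [L.Structure A] [L.Structure B] :
    Set (L.Substructure B) :=
  {S | Nonempty (S ≃[L] A)}

/-- The partition relation `C → (B)^A_{k,d}`: every colouring of the copies of `A` in `C` with `k`
colours takes at most `d` colours on the copies of `A` inside some copy `B'` of `B` in `C`. -/
def RamseyArrow (L : FirstOrder.Language.{u, v}) (k d : ℕ) (A B C : Type w)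
    [L.Structure A] [L.Structure B] [L.Structure C] : Prop :=
  ∀ χ : copies L A C → Fin k, ∃ B' ∈ copies L B C,
    (χ '' {S | (S : L.Substructure C) ≤ B'}).ncard ≤ d

/-- The Ramsey degree of `A` in `K`: the least `d` such that for all `B ∈ K` and `k ≥ 2` there is
`C ∈ K` with `C → (B)^A_{k,d}`, and `∞` if there is no such `d`. -/
noncomputable def ramseyDegreeIn {L : FirstOrder.Language.{u, v}} (K : Set (Bundled.{w} L.Structure))
    (A : Bundled.{w} L.Structure) : ℕ∞ :=
  ⨅ (d : ℕ) (_ : ∀ B ∈ K, ∀ k : ℕ, 2 ≤ k → ∃ C ∈ K, RamseyArrow L k d A B C), (d : ℕ∞)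

/-- The Ramsey degree of a class of structures. -/
noncomputable def ramseyDegree {L : FirstOrder.Language.{u, v}} (K : Set (Bundled.{w} L.Structure)) : ℕ∞ :=
  ⨆ A ∈ K, ramseyDegreeIn K A

/-- A class is Ramsey if its Ramsey degree is `1`. -/
def IsRamsey {L : FirstOrder.Language.{u, v}} (K : Set (Bundled.{w} L.Structure)) : Prop :=
  ramseyDegree K = 1

/-! ### The automorphism group as a topological group -/

/-- Automorphisms form a group under composition. -/
instance autGroup (L : FirstOrder.Language.{u, v}) (F : Type w) [L.Structure F] : Group (F ≃[L] F) where
  mul f g := f.comp g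
  one := FirstOrder.Language.Equiv.refl L F
  inv f := f.symm
  mul_assoc _ _ _ := rfl
  one_mul _ := rfl
  mul_one _ := rfl
  inv_mul_cancel f := by
    apply FirstOrder.Language.Equiv.ext
    intro x
    exact f.symm_apply_apply x

/-- The topology of pointwise convergence, `F` being discrete. The pointwise stabilizers of finite
sets form a basis of neighbourhoods of the identity. -/
instance autTopology (L : FirstOrder.Language.{u, v}) (F : Type w) [L.Structure F] :
    TopologicalSpace (F ≃[L] F) :=
  TopologicalSpace.induced (fun g => (g : F → F)) (@Pi.topologicalSpace F (fun _ => F) fun _ => ⊥)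

/-! ### Flows -/

/-- A `G`-flow: a continuous action of `G` on a compact Hausdorff space. -/
structure IsFlow (G X : Type*) [Group G] [TopologicalSpace G] [TopologicalSpace X]
    [MulAction G X] : Prop where
  compact : CompactSpace X
  hausdorff : T2Space X
  continuous_smul : ContinuousSMul G X

/-- A minimal `G`-flow: a nonempty flow in which every orbit is dense. -/
structure IsMinimalFlow (G X : Type*) [Group G] [TopologicalSpace G] [TopologicalSpace X]
    [MulAction G X] : Prop extends IsFlow G X where
  nonempty : Nonempty X
  minimal : MulAction.IsMinimal G X

/-- `X` is a universal minimal `G`-flow: a minimal flow with a homomorphism into every minimal flow.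
Minimal flows are continuous images of the space of ultrafilters on `G`, so those in the universe
of `G` represent all of them. -/
structure IsUniversalMinimalFlow (G X : Type w) [Group G] [TopologicalSpace G]
    [TopologicalSpace X] [MulAction G X] : Prop extends IsMinimalFlow G X where
  universal : ∀ (Y : Type w) [TopologicalSpace Y] [MulAction G Y], IsMinimalFlow G Y →
    ∃ π : X → Y, Continuous π ∧ ∀ (g : G) (x : X), π (g • x) = g • π x

open MulAction in
/-- Every nonempty flow contains a minimal subflow. -/
theorem IsFlow.exists_minimal {G X : Type*} [Group G] [TopologicalSpace G] [TopologicalSpace X]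
    [MulAction G X] (h : IsFlow G X) [Nonempty X] :
    ∃ Z : SubMulAction G X, IsMinimalFlow G Z := by
  have := h.compact
  have := h.hausdorff
  have := h.continuous_smul
  let S : Set (Set X) := {C | IsClosed C ∧ C.Nonempty ∧ ∀ (g : G), ∀ x ∈ C, g • x ∈ C}
  have hzorn : ∀ c ⊆ S, IsChain (· ⊆ ·) c → c.Nonempty → ∃ lb ∈ S, ∀ s ∈ c, lb ⊆ s := by
    intro c hcS hc hne
    have := hne.to_subtype
    refine ⟨⋂₀ c, ⟨isClosed_sInter fun s hs => (hcS hs).1, ?_, ?_⟩,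
      fun s hs => Set.sInter_subset_of_mem hs⟩
    · exact IsCompact.nonempty_sInter_of_directed_nonempty_isCompact_isClosed (S := c)
        (fun a ha b hb => (hc.total ha hb).elim (fun h => ⟨a, ha, subset_rfl, h⟩)
          fun h => ⟨b, hb, h, subset_rfl⟩) (fun s hs => (hcS hs).2.1) (fun s hs => (hcS hs).1.isCompact)
        (fun s hs => (hcS hs).1)
    · intro g x hx s hs
      exact (hcS hs).2.2 g x (hx s hs)
  obtain ⟨C, -, hC⟩ := zorn_superset_nonempty S hzorn Set.univ
    ⟨isClosed_univ, Set.univ_nonempty, fun _ _ _ => Set.mem_univ _⟩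
  refine ⟨⟨C, fun g x hx => hC.1.2.2 g _ hx⟩, ⟨⟨?_, ?_, ?_⟩, ?_, ⟨?_⟩⟩⟩
  · exact isCompact_iff_compactSpace.1 hC.1.1.isCompact
  · exact inferInstanceAs (T2Space C)
  · exact ⟨Continuous.subtype_mk
      (continuous_fst.smul (continuous_subtype_val.comp continuous_snd)) _⟩
  · exact hC.1.2.1.to_subtype
  · rintro ⟨x, hx⟩
    have hsub : closure (orbit G x) ⊆ C :=
      closure_minimal (by rintro _ ⟨g, rfl⟩; exact hC.1.2.2 g x hx) hC.1.1
    have hmem : closure (orbit G x) ∈ S := by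
      refine ⟨isClosed_closure, (nonempty_orbit x).closure, fun g y hy => ?_⟩
      exact smul_closure_orbit_subset g x (Set.smul_mem_smul_set hy)
    have heq : C ⊆ closure (orbit G x) := hC.2 hmem hsub
    intro y
    rw [closure_subtype]
    refine closure_mono ?_ (heq y.2)
    rintro _ ⟨g, rfl⟩
    exact ⟨g • ⟨x, hx⟩, ⟨g, rfl⟩, rfl⟩

/-- Every topological group has a universal minimal flow. -/
theorem exists_isUniversalMinimalFlow (G : Type w) [Group G] [TopologicalSpace G] :
    ∃ (X : Type w) (_ : TopologicalSpace X) (_ : MulAction G X), IsUniversalMinimalFlow G X := by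
  -- representatives of all minimal flows, on quotients of the set of ultrafilters on `G`
  let I : Type w := Σ s : Setoid (Ultrafilter G),
    {p : TopologicalSpace (Quotient s) × MulAction G (Quotient s) //
      @IsMinimalFlow G (Quotient s) _ _ p.1 p.2}
  let P : I → Type w := fun i => Quotient i.1
  let _ : ∀ i, TopologicalSpace (P i) := fun i => i.2.1.1
  let _ : ∀ i, MulAction G (P i) := fun i => i.2.1.2
  have hP : ∀ i, IsMinimalFlow G (P i) := fun i => i.2.2
  have := fun i => (hP i).compact
  have := fun i => (hP i).hausdorff
  have := fun i => (hP i).continuous_smul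
  have := fun i => (hP i).nonempty
  have hF : IsFlow G (∀ i, P i) := ⟨inferInstance, inferInstance,
    ⟨continuous_pi fun i => continuous_fst.smul ((continuous_apply i).comp continuous_snd)⟩⟩
  obtain ⟨Z, hZ⟩ := hF.exists_minimal
  refine ⟨Z, inferInstance, inferInstance, hZ, fun Y _ _ hY => ?_⟩
  have := hY.compact
  have := hY.hausdorff
  have := hY.continuous_smul
  obtain ⟨y⟩ := hY.nonempty
  let f : Ultrafilter G → Y := Ultrafilter.extend fun g : G => g • y
  have hf : Continuous f := continuous_ultrafilter_extend _
  have hsurj : Function.Surjective f := by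
    rw [← Set.range_eq_univ, ← (isCompact_range hf).isClosed.closure_eq]
    refine ((hY.minimal.dense_orbit y).mono ?_).closure_eq
    rintro _ ⟨g, rfl⟩
    exact ⟨pure g, congrFun (ultrafilter_extend_extends fun g : G => g • y) g⟩
  let s : Setoid (Ultrafilter G) := Setoid.ker f
  let e : Quotient s ≃ Y := Setoid.quotientKerEquivOfSurjective f hsurj
  let t : TopologicalSpace (Quotient s) := TopologicalSpace.induced e inferInstance
  let a : MulAction G (Quotient s) := e.mulAction G
  let h : Quotient s ≃ₜ Y := e.toHomeomorphOfIsInducing ⟨rfl⟩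
  have hsm : ∀ (g : G) (q : Quotient s), e (g • q) = g • e q := fun g q =>
    e.apply_symm_apply _
  have hQ : IsMinimalFlow G (Quotient s) := by
    refine ⟨⟨h.symm.compactSpace, h.symm.t2Space, ⟨?_⟩⟩, ⟨e.symm y⟩, ⟨fun q => ?_⟩⟩
    · refine (h.comp_continuous_iff).1 ?_
      have : Continuous fun p : G × Quotient s => p.1 • h p.2 :=
        continuous_fst.smul (h.continuous.comp continuous_snd)
      exact this.congr fun p => (hsm p.1 p.2).symm
    · have := (hY.minimal.dense_orbit (e q)).preimage h.isOpenMap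
      refine this.mono ?_
      rintro q' ⟨g, hg⟩
      exact ⟨g, e.injective ((hsm g q).trans hg)⟩
  let i : I := ⟨s, ⟨(t, a), hQ⟩⟩
  refine ⟨fun z => h ((z : ∀ i, P i) i), ?_, fun g z => hsm g _⟩
  exact h.continuous.comp ((continuous_apply i).comp continuous_subtype_val)

/-- `μ` is a `G`-invariant Borel probability measure on `X`. -/
structure IsInvariantProbability (G : Type*) {X : Type*} [Group G] [MulAction G X]
    [MeasurableSpace X] (μ : Measure X) : Prop where
  isProbability : IsProbabilityMeasure μ
  invariant : SMulInvariantMeasure G X μ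

/-- `O` is an orbit of `G` on `X` that is a dense `G_δ` set. -/
structure IsDenseGδOrbit (G : Type*) {X : Type*} [Group G] [TopologicalSpace X] [MulAction G X]
    (O : Set X) : Prop where
  isOrbit : ∃ x : X, O = MulAction.orbit G x
  dense : Dense O
  isGδ : IsGδ O

/-
The strict linear orders on `F` form a compact flow, so by universality each point of `M` carries a
linear order on `F`, equivariantly and with clopen dependence on the point. The Ramsey property
makes this family of orders homogeneous: any two of them are isomorphic on each finite set through
an element of its stabilizer, and finite pieces of them amalgamate. Together with minimality and the
uniform continuity of continuous functions on `M` it also shows that a point is determined by its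
order. By homogeneity the order induced on a finite set is uniformly distributed among those that
occur, for every invariant probability measure, so there is only one such measure.

The points whose order realises every one-point extension that occurs at some point of `M` form a
dense `G_δ` set, which is a single orbit by back-and-forth; by Baire it is the only dense `G_δ`
orbit. It has full measure because an extension that occurs is realised with conditional probability
at least `1/32`. If the new point can occupy few positions, homogeneity gives this at once.
Otherwise take several elements of its orbit and the events that they lie in the prescribed
position: cyclic shifts of the positions generate a two-transitive group, so the pairwise
intersections of these events are small, and Bonferroni's inequality bounds their union from below.
The same bound inside every cylinder forces the exceptional set to be null.
-/

namespace OrderFlow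

noncomputable section

open scoped Classical Finset Pointwise

section Rank

variable {F : Type*} {r r' r'' : F → F → Prop} {A B S : Finset F} {c u v : F} {i : ℕ}

/-- The relations `r` and `r'` have the same restriction to `B`. -/
def AgreeOn (B : Finset F) (r r' : F → F → Prop) : Prop :=
  ∀ a ∈ B, ∀ b ∈ B, (r a b ↔ r' a b)

theorem AgreeOn.refl (B : Finset F) (r : F → F → Prop) : AgreeOn B r r := fun _ _ _ _ => Iff.rfl

theorem AgreeOn.symm (h : AgreeOn B r r') : AgreeOn B r' r := fun a ha b hb => (h a ha b hb).symm

theorem AgreeOn.trans (h : AgreeOn B r r') (h' : AgreeOn B r' r'') : AgreeOn B r r'' :=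
  fun a ha b hb => (h a ha b hb).trans (h' a ha b hb)

theorem AgreeOn.mono (h : AgreeOn B r r') (hAB : A ⊆ B) : AgreeOn A r r' :=
  fun a ha b hb => h a (hAB ha) b (hAB hb)

/-- The rank of `u` over `S`: the number of elements of `S` that `r` puts below `u`. The element `u`
need not belong to `S`. -/
def rk (r : F → F → Prop) (S : Finset F) (u : F) : ℕ := #{a ∈ S | r a u}

theorem AgreeOn.rk_eq (h : AgreeOn B r r') (hS : S ⊆ B) (hu : u ∈ B) : rk r S u = rk r' S u :=
  congrArg Finset.card (Finset.filter_congr fun a ha => h a (hS ha) u hu)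

theorem rk_lt_card [Std.Irrefl r] (hu : u ∈ S) : rk r S u < #S :=
  Finset.card_lt_card (Finset.filter_ssubset.2 ⟨u, hu, irrefl u⟩)

theorem rk_le_rk [IsTrans F r] (h : r u v) : rk r S u ≤ rk r S v :=
  Finset.card_le_card (Finset.monotone_filter_right S fun _ _ ha => _root_.trans ha h)

theorem rk_lt_rk [IsStrictOrder F r] (hu : u ∈ S) (h : r u v) : rk r S u < rk r S v := by
  refine Finset.card_lt_card (Finset.ssubset_iff_of_subset
    (Finset.monotone_filter_right S fun _ _ ha => _root_.trans ha h) |>.2 ⟨u, ?_, ?_⟩)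
  · exact Finset.mem_filter.2 ⟨hu, h⟩
  · simp only [Finset.mem_filter, irrefl u, and_false, not_false_eq_true]

theorem lt_iff_rk_lt_rk [IsStrictTotalOrder F r] (hu : u ∈ S) (hv : v ∈ S) :
    r u v ↔ rk r S u < rk r S v := by
  refine ⟨rk_lt_rk hu, fun h => ?_⟩
  rcases trichotomous_of r u v with huv | rfl | hvu
  · exact huv
  · exact absurd h (lt_irrefl _)
  · exact absurd h (rk_lt_rk hv hvu).not_gt

theorem injOn_rk [IsStrictTotalOrder F r] : Set.InjOn (rk r S) S := fun u hu v hv h => by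
  rcases trichotomous_of r u v with huv | huv | hvu
  · exact absurd h (rk_lt_rk hu huv).ne
  · exact huv
  · exact absurd h (rk_lt_rk hv hvu).ne'

theorem exists_rk_eq [IsStrictTotalOrder F r] (hi : i < #S) : ∃ u ∈ S, rk r S u = i :=
  Finset.surjOn_of_injOn_of_card_le (t := Finset.range #S) (rk r S)
    (fun _ hu => Finset.mem_coe.2 (Finset.mem_range.2 (rk_lt_card hu))) injOn_rk
    (Finset.card_range _).le (Finset.mem_coe.2 (Finset.mem_range.2 hi))

theorem rk_insert (hc : c ∉ S) (u : F) :
    rk r (insert c S) u = rk r S u + if r c u then 1 else 0 := by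
  unfold rk
  rw [Finset.filter_insert]
  split_ifs
  · exact Finset.card_insert_of_notMem fun h => hc (Finset.mem_of_mem_filter c h)
  · rfl

theorem rk_insert_self [Std.Irrefl r] : rk r (insert c S) c = rk r S c := by
  unfold rk
  rw [Finset.filter_insert, if_neg (irrefl c)]

theorem lt_iff_rk_le_rk [IsStrictTotalOrder F r] (hc : c ∉ S) (hv : v ∈ S) :
    r c v ↔ rk r S c ≤ rk r S v := by
  refine ⟨rk_le_rk, fun h => ?_⟩
  rcases trichotomous_of r c v with hcv | rfl | hvc
  · exact hcv
  · exact absurd hv hc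
  · exact absurd h (rk_lt_rk hv hvc).not_ge

theorem AgreeOn.insert_of_rk_eq [IsStrictTotalOrder F r] [IsStrictTotalOrder F r'] (hc : c ∉ A)
    (h : AgreeOn A r r') (hrk : rk r A c = rk r' A c) : AgreeOn (insert c A) r r' := by
  have hrk_insert : ∀ b ∈ insert c A, rk r (insert c A) b = rk r' (insert c A) b := by
    intro b hb
    rcases Finset.mem_insert.1 hb with rfl | hb
    · rw [rk_insert_self, rk_insert_self, hrk]
    · rw [rk_insert hc, rk_insert hc, h.rk_eq subset_rfl hb]
      simp only [lt_iff_rk_le_rk hc hb, hrk, h.rk_eq subset_rfl hb]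
  intro a ha b hb
  rw [lt_iff_rk_lt_rk (r := r) ha hb, lt_iff_rk_lt_rk (r := r') ha hb, hrk_insert a ha,
    hrk_insert b hb]

end Rank

section Cycle

/-- The cycle `p → p + 1 → ⋯ → q → p`, fixing all other numbers. -/
def cyc (p q i : ℕ) : ℕ := if i < p then i else if i < q then i + 1 else if i = q then p else i

variable {l p q h i j n : ℕ}

theorem iterate_cyc_of_lt (hi : i < p) : (cyc p q)^[n] i = i :=
  Function.IsFixedPt.iterate (show cyc p q i = i from if_pos hi) n

theorem iterate_cyc_of_gt (hpq : p ≤ q) (hi : q < i) : (cyc p q)^[n] i = i :=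
  Function.IsFixedPt.iterate (show cyc p q i = i by grind [cyc]) n

theorem iterate_cyc_add (hi : p ≤ i) (hin : i + n ≤ q) : (cyc p q)^[n] i = i + n := by
  induction n with
  | zero => rfl
  | succ n ih =>
    rw [Function.iterate_succ_apply', ih (by omega)]
    grind [cyc]

theorem mapsTo_cyc (hlp : l ≤ p) (hpq : p ≤ q) (hqh : q ≤ h) :
    Set.MapsTo (cyc p q) (Set.Icc l h) (Set.Icc l h) := by
  rintro i ⟨hli, hih⟩
  grind [cyc]

theorem cyc_injective (hpq : p ≤ q) : Function.Injective (cyc p q) := by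
  intro i j hij
  grind [cyc]

theorem rel_iterate {α : Type*} {E : Setoid (α × α)} {f : α → α} {s : Set α}
    (hf : Set.MapsTo f s s) (hE : ∀ a ∈ s, ∀ b ∈ s, E (a, b) (f a, f b)) (n : ℕ) {a b : α}
    (ha : a ∈ s) (hb : b ∈ s) : E (a, b) (f^[n] a, f^[n] b) := by
  induction n with
  | zero => exact E.refl _
  | succ n ih =>
    rw [Function.iterate_succ_apply', Function.iterate_succ_apply']
    exact E.trans ih (hE _ (hf.iterate n ha) _ (hf.iterate n hb))

section TwoTransitive

variable {E : Setoid (ℕ × ℕ)} (hlq : l < q) (hqh : q < h)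
  (hleft : ∀ i ∈ Set.Icc l h, ∀ j ∈ Set.Icc l h, E (i, j) (cyc l q i, cyc l q j))
  (hright : ∀ i ∈ Set.Icc l h, ∀ j ∈ Set.Icc l h, E (i, j) (cyc q h i, cyc q h j))
include hlq hqh hleft hright

theorem rel_of_le_of_le (hli : l ≤ i) (hiq : i ≤ q) (hqj : q ≤ j) (hjh : j ≤ h) (hij : i ≠ j) :
    E (i, j) (l, h) := by
  have move_fst : ∀ {i j}, l ≤ i → i ≤ q → q < j → j ≤ h → E (l, j) (i, j) := by
    intro i j hli hiq hqj hjh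
    have := rel_iterate (mapsTo_cyc le_rfl hlq.le hqh.le) hleft (i - l) (a := l) (b := j)
      ⟨le_rfl, by omega⟩ ⟨by omega, hjh⟩
    rwa [iterate_cyc_add le_rfl (by omega), iterate_cyc_of_gt hlq.le hqj,
      Nat.add_sub_cancel' hli] at this
  have move_snd : ∀ {i j}, l ≤ i → i < q → q ≤ j → j ≤ h → E (i, q) (i, j) := by
    intro i j hli hiq hqj hjh
    have := rel_iterate (mapsTo_cyc hlq.le hqh.le le_rfl) hright (j - q) (a := i) (b := q)
      ⟨hli, by omega⟩ ⟨hlq.le, hqh.le⟩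
    rwa [iterate_cyc_of_lt hiq, iterate_cyc_add le_rfl (by omega),
      Nat.add_sub_cancel' hqj] at this
  rcases hqj.lt_or_eq with hqj | rfl
  · calc E (i, j) (l, j) := E.symm (move_fst hli hiq hqj hjh)
      E _ (l, q) := E.symm (move_snd le_rfl hlq hqj.le hjh)
      E _ (l, h) := move_snd le_rfl hlq hqh.le le_rfl
  · calc E (i, q) (i, h) := move_snd hli (by omega) hqh.le le_rfl
      E _ (l, h) := E.symm (move_fst hli hiq hqh le_rfl)

theorem rel_of_le (hi : i ∈ Set.Icc l h) (hiq : i ≤ q) (hj : j ∈ Set.Icc l h) (hij : i ≠ j) :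
    E (i, j) (l, h) := by
  rcases le_or_gt q j with hqj | hjq
  · exact rel_of_le_of_le hlq hqh hleft hright hi.1 hiq hqj hj.2 hij
  have hrel := rel_iterate (mapsTo_cyc le_rfl hlq.le hqh.le) hleft (q - j) hi hj
  have hi' := (mapsTo_cyc le_rfl hlq.le le_rfl).iterate (q - j) ⟨hi.1, hiq⟩
  have hne := ((cyc_injective hlq.le).iterate (q - j)).ne hij
  rw [iterate_cyc_add hj.1 (by omega), Nat.add_sub_cancel' hjq.le] at hrel hne
  exact E.trans hrel (rel_of_le_of_le hlq hqh hleft hright hi'.1 hi'.2 le_rfl hqh.le hne)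

/-- The cycles on `[l, q]` and `[q, h]` generate a group that is two-transitive on `[l, h]`. -/
theorem rel_of_rel_cyc (hi : i ∈ Set.Icc l h) (hj : j ∈ Set.Icc l h) (hij : i ≠ j) :
    E (i, j) (l, h) := by
  rcases le_or_gt i q with hiq | hqi
  · exact rel_of_le hlq hqh hleft hright hi hiq hj hij
  have hmaps := mapsTo_cyc hlq.le hqh.le (le_refl h)
  have hrel := rel_iterate hmaps hright (h - i + 1) hi hj
  have hi' : (cyc q h)^[h - i + 1] i = q := by
    rw [Function.iterate_succ_apply', iterate_cyc_add hqi.le (Nat.add_sub_cancel' hi.2).le,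
      Nat.add_sub_cancel' hi.2]
    grind [cyc]
  have hne := ((cyc_injective hqh.le).iterate (h - i + 1)).ne hij
  rw [hi'] at hrel hne
  exact E.trans hrel (rel_of_le hlq hqh hleft hright ⟨hlq.le, hqh.le⟩ le_rfl
    (hmaps.iterate _ hj) hne)

end TwoTransitive

end Cycle

section EquivariantOrder

open MulAction

theorem mem_stabilizer_of_mem_fixingSubgroup {G F : Type*} [Group G] [MulAction G F] {g : G}
    {S : Finset F} (hg : g ∈ fixingSubgroup G (S : Set F)) : g ∈ stabilizer G S :=
  mem_stabilizer_finset_iff_subset_smul_finset.2 fun b hb =>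
    Finset.mem_smul_finset.2 ⟨b, hb, (mem_fixingSubgroup_iff G).1 hg b hb⟩

/-- An equivariant assignment of strict linear orders on `F` to the points of `M`. -/
structure EquivariantOrder (G F M : Type*) [Group G] [MulAction G F] [MulAction G M] where
  lt : M → F → F → Prop
  isStrictTotalOrder : ∀ m, IsStrictTotalOrder F (lt m)
  smul_lt_smul_iff : ∀ (g : G) m a b, lt (g • m) (g • a) (g • b) ↔ lt m a b

attribute [instance] EquivariantOrder.isStrictTotalOrder

namespace EquivariantOrder

variable {G F M : Type*} [Group G] [MulAction G F] [MulAction G M] {o : EquivariantOrder G F M}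
  {A S : Finset F} {b c : F} {g : G} {m m' m₀ : M} {p q : ℕ}

variable (o) in
/-- Any two orders of `o` are isomorphic on each finite set, and finite pieces of the orders can be
amalgamated: an order on `C` and an order on `insert c A` that agree on `A ⊆ C` are both realised by
a single point of `M`, up to moving `c` by the stabilizer of `A`. -/
structure IsHomogeneous : Prop where
  transitive : ∀ (B : Finset F) m m', ∃ g ∈ stabilizer G B, AgreeOn B (o.lt (g • m)) (o.lt m')
  amalgamation : ∀ A C : Finset F, A ⊆ C → ∀ c m m', AgreeOn A (o.lt m) (o.lt m') →
    ∃ m'', ∃ g ∈ fixingSubgroup G (A : Set F),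
      AgreeOn C (o.lt m'') (o.lt m) ∧ AgreeOn (insert c A) (o.lt (g • m'')) (o.lt m')

theorem agreeOn_smul_iff :
    AgreeOn (g • S) (o.lt (g • m)) (o.lt (g • m')) ↔ AgreeOn S (o.lt m) (o.lt m') := by
  simp only [AgreeOn, Finset.smul_finset_def, Finset.forall_mem_image, o.smul_lt_smul_iff]

theorem agreeOn_smul_of_mem_stabilizer (hg : g ∈ stabilizer G S)
    (h : AgreeOn S (o.lt m) (o.lt m')) : AgreeOn S (o.lt (g • m)) (o.lt (g • m')) := by
  rw [← mem_stabilizer_iff.1 hg]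
  exact agreeOn_smul_iff.2 h

theorem agreeOn_smul_of_mem_fixingSubgroup (hg : g ∈ fixingSubgroup G (S : Set F)) (m : M) :
    AgreeOn S (o.lt (g • m)) (o.lt m) := fun a ha b hb => by
  rw [mem_fixingSubgroup_iff] at hg
  conv_lhs => rw [← hg a ha, ← hg b hb]
  exact o.smul_lt_smul_iff g m a b

theorem agreeOn_insert_smul_iff (hg : g ∈ fixingSubgroup G (A : Set F)) :
    AgreeOn (insert c A) (o.lt (g • m)) (o.lt (g • m')) ↔
      AgreeOn (insert (g⁻¹ • c) A) (o.lt m) (o.lt m') := by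
  rw [← agreeOn_smul_iff (g := g) (S := insert (g⁻¹ • c) A), Finset.smul_finset_insert,
    smul_inv_smul, mem_stabilizer_iff.1 (mem_stabilizer_of_mem_fixingSubgroup hg)]

variable (o) in
theorem rk_smul (g : G) (m : M) (S : Finset F) (u : F) :
    rk (o.lt (g • m)) (g • S) (g • u) = rk (o.lt m) S u := by
  rw [rk, rk, ← Finset.card_smul_finset g (Finset.filter _ S)]
  congr 1
  ext b
  rw [Finset.mem_filter, ← Finset.inv_smul_mem_iff, ← Finset.inv_smul_mem_iff, Finset.mem_filter,
    ← o.smul_lt_smul_iff g m, smul_inv_smul]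

theorem rk_smul_of_mem_stabilizer (hg : g ∈ stabilizer G S) (m : M) (u : F) :
    rk (o.lt (g • m)) S (g • u) = rk (o.lt m) S u := by
  conv_lhs => rw [← mem_stabilizer_iff.1 hg]
  exact o.rk_smul g m S u

theorem rk_smul_of_agreeOn (hg : g ∈ stabilizer G S) (h : AgreeOn S (o.lt (g • m)) (o.lt m'))
    (hb : b ∈ S) : rk (o.lt m') S (g • b) = rk (o.lt m) S b := by
  rw [← h.rk_eq subset_rfl ((mem_stabilizer_finset.1 hg b).2 hb), rk_smul_of_mem_stabilizer hg]

theorem smul_eq_of_rk_eq (hg : g ∈ stabilizer G S) (h : AgreeOn S (o.lt (g • m)) (o.lt m'))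
    (hb : b ∈ S) (hrk : rk (o.lt m') S b = rk (o.lt m) S b) : g • b = b :=
  injOn_rk ((mem_stabilizer_finset.1 hg b).2 hb) hb ((rk_smul_of_agreeOn hg h hb).trans hrk.symm)

theorem mem_fixingSubgroup_of_agreeOn (hg : g ∈ stabilizer G S)
    (h : AgreeOn S (o.lt (g • m)) (o.lt m)) : g ∈ fixingSubgroup G (S : Set F) :=
  (mem_fixingSubgroup_iff G).2 fun _ hb => smul_eq_of_rk_eq hg h hb rfl

variable (o) in
/-- The gaps of `c` over `A`: the ranks of `c` over `A` in the orders that agree with the order of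
`m₀` on `A`. -/
def gaps (A : Finset F) (c : F) (m₀ : M) : Finset ℕ :=
  {p ∈ Finset.range (#A + 1) | ∃ m, AgreeOn A (o.lt m) (o.lt m₀) ∧ rk (o.lt m) A c = p}

theorem mem_gaps :
    p ∈ o.gaps A c m₀ ↔ ∃ m, AgreeOn A (o.lt m) (o.lt m₀) ∧ rk (o.lt m) A c = p := by
  refine Finset.mem_filter.trans (and_iff_right_of_imp ?_)
  rintro ⟨m, -, rfl⟩
  exact Finset.mem_range_succ_iff.2 (Finset.card_filter_le _ _)

theorem rk_mem_gaps (h : AgreeOn A (o.lt m) (o.lt m₀)) : rk (o.lt m) A c ∈ o.gaps A c m₀ :=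
  mem_gaps.2 ⟨m, h, rfl⟩

theorem rk_insert_eq_cyc (hc : c ∉ A) {m m' : M} (h : AgreeOn A (o.lt m) (o.lt m'))
    (hlt : rk (o.lt m) A c < rk (o.lt m') A c) (hb : b ∈ insert c A) :
    rk (o.lt m) (insert c A) b =
      cyc (rk (o.lt m) A c) (rk (o.lt m') A c) (rk (o.lt m') (insert c A) b) := by
  rcases Finset.mem_insert.1 hb with rfl | hbA
  · rw [rk_insert_self, rk_insert_self]
    grind [cyc]
  · rw [rk_insert hc, rk_insert hc, lt_iff_rk_le_rk (r := o.lt m) hc hbA,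
      lt_iff_rk_le_rk (r := o.lt m') hc hbA, h.rk_eq subset_rfl hbA]
    grind [cyc]

theorem IsHomogeneous.exists_smul_cyc (H : o.IsHomogeneous) (hc : c ∉ A)
    (hp : p ∈ o.gaps A c m₀) (hq : q ∈ o.gaps A c m₀) (hpq : p < q) :
    ∃ g ∈ stabilizer G (insert c A), ∀ b ∈ insert c A,
      rk (o.lt m₀) (insert c A) (g • b) = cyc p q (rk (o.lt m₀) (insert c A) b) := by
  obtain ⟨mp, hmp, rfl⟩ := mem_gaps.1 hp
  obtain ⟨mq, hmq, rfl⟩ := mem_gaps.1 hq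
  obtain ⟨s, hs, hsA⟩ := H.transitive (insert c A) m₀ mp
  obtain ⟨t, ht, htA⟩ := H.transitive (insert c A) m₀ mq
  have hst := mul_mem (inv_mem hs) ht
  refine ⟨s⁻¹ * t, hst, fun b hb => ?_⟩
  rw [← rk_smul_of_agreeOn hs hsA ((mem_stabilizer_finset.1 hst b).2 hb), mul_smul, smul_inv_smul,
    rk_insert_eq_cyc hc (hmp.trans hmq.symm) hpq ((mem_stabilizer_finset.1 ht b).2 hb),
    rk_smul_of_agreeOn ht htA hb]

end EquivariantOrder

/-- A point `pt` outside of a finite set `base` with at least three gaps over it, in orders that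
agree with the order of `ref` on `base`. The smallest gap is `lo` and the largest is `hi`. -/
structure Block {G F M : Type*} [Group G] [MulAction G F] [MulAction G M]
    (o : EquivariantOrder G F M) where
  base : Finset F
  pt : F
  ref : M
  lo : ℕ
  hi : ℕ
  pt_notMem : pt ∉ base
  lo_mem_gaps : lo ∈ o.gaps base pt ref
  hi_mem_gaps : hi ∈ o.gaps base pt ref
  exists_mid : ∃ q ∈ o.gaps base pt ref, lo < q ∧ q < hi
  gaps_subset : o.gaps base pt ref ⊆ Finset.Icc lo hi

namespace Block

open EquivariantOrder

variable {G F M : Type*} [Group G] [MulAction G F] [MulAction G M] {o : EquivariantOrder G F M}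
  (D : Block o) {g : G} {u' v' u v : F}

/-- The base of a block together with its point. -/
def dom : Finset F := insert D.pt D.base

/-- The rank over `D.dom` in the order of `D.ref`. -/
def pos (u : F) : ℕ := rk (o.lt D.ref) D.dom u

/-- The rank of the point of a block over the base, in the order of `D.ref`. -/
def gap : ℕ := rk (o.lt D.ref) D.base D.pt

/-- The elements of `D.dom` whose positions lie between the smallest and the largest gap. -/
def inner : Finset F := {u ∈ D.dom | D.pos u ∈ Finset.Icc D.lo D.hi}

/-- The elements of `D.dom` whose positions lie outside the range of the gaps. -/
def outer : Finset F := D.dom \ D.inner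

variable (G) in
/-- The elements of `G` that stabilize `D.dom` and fix `D.outer` pointwise. -/
def group : Subgroup G := stabilizer G D.dom ⊓ fixingSubgroup G (D.outer : Set F)

theorem lo_lt_hi : D.lo < D.hi :=
  let ⟨_, _, h, h'⟩ := D.exists_mid
  h.trans h'

theorem pt_mem_dom : D.pt ∈ D.dom := Finset.mem_insert_self _ _

theorem mem_inner : u ∈ D.inner ↔ u ∈ D.dom ∧ D.lo ≤ D.pos u ∧ D.pos u ≤ D.hi := by
  rw [inner, Finset.mem_filter, Finset.mem_Icc]

theorem mem_outer : u ∈ D.outer ↔ u ∈ D.dom ∧ (D.pos u < D.lo ∨ D.hi < D.pos u) := by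
  rw [outer, Finset.mem_sdiff, mem_inner]
  grind

theorem pos_pt : D.pos D.pt = D.gap := rk_insert_self

theorem gap_mem_Icc : D.gap ∈ Finset.Icc D.lo D.hi := D.gaps_subset (rk_mem_gaps (AgreeOn.refl _ _))

theorem pt_mem_inner : D.pt ∈ D.inner :=
  Finset.mem_filter.2 ⟨D.pt_mem_dom, D.pos_pt ▸ D.gap_mem_Icc⟩

theorem inner_subset_dom : D.inner ⊆ D.dom := Finset.filter_subset _ _

theorem outer_subset_dom : D.outer ⊆ D.dom := Finset.sdiff_subset

theorem pt_notMem_outer : D.pt ∉ D.outer := fun h => (Finset.mem_sdiff.1 h).2 D.pt_mem_inner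

theorem outer_subset_base : D.outer ⊆ D.base := fun _ hr =>
  (Finset.mem_insert.1 (D.outer_subset_dom hr)).resolve_left fun h => D.pt_notMem_outer (h ▸ hr)

theorem hi_lt_card_dom : D.hi < #D.dom := by
  obtain ⟨m, -, hm⟩ := mem_gaps.1 D.hi_mem_gaps
  rw [dom, Finset.card_insert_of_notMem D.pt_notMem, Nat.lt_succ_iff, ← hm]
  exact Finset.card_filter_le _ _

theorem smul_mem_dom (hg : g ∈ D.group G) : g • u ∈ D.dom ↔ u ∈ D.dom :=
  mem_stabilizer_finset.1 hg.1 u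

theorem exists_smul_pos_eq_cyc (H : o.IsHomogeneous) {p q : ℕ}
    (hp : p ∈ o.gaps D.base D.pt D.ref) (hq : q ∈ o.gaps D.base D.pt D.ref) (hpq : p < q) :
    ∃ g ∈ D.group G, ∀ u ∈ D.dom, D.pos (g • u) = cyc p q (D.pos u) := by
  obtain ⟨g, hg, hpos⟩ := H.exists_smul_cyc D.pt_notMem hp hq hpq
  refine ⟨g, ⟨hg, (mem_fixingSubgroup_iff G).2 fun r hr => ?_⟩, hpos⟩
  have hr' := D.mem_outer.1 hr
  have hlo := Finset.mem_Icc.1 (D.gaps_subset hp)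
  have hhi := Finset.mem_Icc.1 (D.gaps_subset hq)
  refine injOn_rk ((mem_stabilizer_finset.1 hg r).2 hr'.1) hr'.1 ((hpos r hr'.1).trans ?_)
  change cyc p q (D.pos r) = D.pos r
  grind [cyc]

theorem exists_smul_pair (H : o.IsHomogeneous) (hu : u ∈ D.inner) (hv : v ∈ D.inner) (huv : u ≠ v)
    (hu' : u' ∈ D.inner) (hv' : v' ∈ D.inner) (huv' : u' ≠ v') :
    ∃ g ∈ D.group G, g • u = u' ∧ g • v = v' := by
  have hpos_inj : Set.InjOn D.pos D.dom := injOn_rk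
  have hex : ∀ i, i ∈ Set.Icc D.lo D.hi → ∃ e ∈ D.dom, D.pos e = i := fun i hi =>
    exists_rk_eq (hi.2.trans_lt D.hi_lt_card_dom)
  have : Nonempty F := ⟨D.pt⟩
  choose! e he hpos using hex
  have he_pos : ∀ {w}, w ∈ D.inner → D.pos w ∈ Set.Icc D.lo D.hi ∧ e (D.pos w) = w := by
    intro w hw
    have hw' := D.mem_inner.1 hw
    exact ⟨hw'.2, hpos_inj (he _ hw'.2) hw'.1 (hpos _ hw'.2)⟩
  let E : Setoid (ℕ × ℕ) := Setoid.comap (Prod.map e e) (orbitRel (D.group G) (F × F))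
  have hcyc : ∀ p ∈ o.gaps D.base D.pt D.ref, ∀ q ∈ o.gaps D.base D.pt D.ref, p < q →
      ∀ i ∈ Set.Icc D.lo D.hi, ∀ j ∈ Set.Icc D.lo D.hi, E (i, j) (cyc p q i, cyc p q j) := by
    intro p hp q hq hpq i hi j hj
    obtain ⟨g, hg, hgpos⟩ := D.exists_smul_pos_eq_cyc H hp hq hpq
    have hmaps := mapsTo_cyc (Finset.mem_Icc.1 (D.gaps_subset hp)).1 hpq.le
      (Finset.mem_Icc.1 (D.gaps_subset hq)).2
    have hge : ∀ k ∈ Set.Icc D.lo D.hi, g • e k = e (cyc p q k) := fun k hk =>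
      hpos_inj ((D.smul_mem_dom hg).2 (he k hk)) (he _ (hmaps hk))
        (by rw [hgpos _ (he k hk), hpos k hk, hpos _ (hmaps hk)])
    exact E.symm ⟨⟨g, hg⟩, Prod.ext (hge i hi) (hge j hj)⟩
  obtain ⟨q, hq, hlq, hqh⟩ := D.exists_mid
  have hpair : ∀ {u v}, u ∈ D.inner → v ∈ D.inner → u ≠ v →
      E (D.pos u, D.pos v) (D.lo, D.hi) := fun {u v} hu hv huv =>
    rel_of_rel_cyc hlq hqh (hcyc _ D.lo_mem_gaps _ hq hlq) (hcyc _ hq _ D.hi_mem_gaps hqh)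
      (he_pos hu).1 (he_pos hv).1 (hpos_inj.ne (D.inner_subset_dom hu) (D.inner_subset_dom hv) huv)
  obtain ⟨⟨g, hg⟩, hgE⟩ := E.trans (hpair hu' hv' huv') (E.symm (hpair hu hv huv))
  simp only [Prod.map_apply, (he_pos hu).2, (he_pos hv).2, (he_pos hu').2, (he_pos hv').2] at hgE
  exact ⟨g, hg, congrArg Prod.fst hgE, congrArg Prod.snd hgE⟩

end Block

end EquivariantOrder

section Measure

open MulAction

section

variable {ι G M : Type*} [MeasurableSpace M] {μ : Measure M}

theorem sum_measureReal_sub_le_measureReal_biUnion [IsFiniteMeasure μ] (s : Finset ι)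
    {E : ι → Set M} (hE : ∀ i, MeasurableSet (E i)) :
    ∑ i ∈ s, μ.real (E i) - ∑ p ∈ s.offDiag, μ.real (E p.1 ∩ E p.2) ≤ μ.real (⋃ i ∈ s, E i) := by
  induction s using Finset.induction_on with
  | empty => simp
  | insert i s hi ih =>
    rw [Finset.set_biUnion_insert, Finset.sum_insert hi]
    have hunion := measureReal_union_add_inter (μ := μ) (s := E i)
      (Finset.measurableSet_biUnion s fun j _ => hE j) (measure_ne_top _ _) (measure_ne_top _ _)
    have hinter : μ.real (E i ∩ ⋃ j ∈ s, E j) ≤ ∑ j ∈ s, μ.real (E i ∩ E j) := by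
      rw [Set.inter_iUnion₂]
      exact measureReal_biUnion_finset_le s _
    have hsub : ({i} : Finset ι) ×ˢ s ∪ s.offDiag ⊆ (insert i s).offDiag := by
      grind
    have hdisj : Disjoint (({i} : Finset ι) ×ˢ s) s.offDiag :=
      Finset.disjoint_left.2 (by grind)
    have hsum := Finset.sum_le_sum_of_subset_of_nonneg hsub
      fun p _ _ => (measureReal_nonneg : 0 ≤ μ.real (E p.1 ∩ E p.2))
    rw [Finset.sum_union hdisj, Finset.sum_product, Finset.sum_singleton] at hsum
    linarith

theorem measureReal_eq_of_smul_mem_iff [Group G] [MulAction G M] [SMulInvariantMeasure G M μ]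
    {s t : Set M} (ht : MeasurableSet t) {g : G} (h : ∀ m, g • m ∈ t ↔ m ∈ s) :
    μ.real s = μ.real t := by
  have hpre : s = (fun m => g • m) ⁻¹' t := Set.ext fun m => (h m).symm
  rw [Measure.real, Measure.real, hpre, SMulInvariantMeasure.measure_preimage_smul g ht]

end

namespace EquivariantOrder

variable {G F M : Type*} [Group G] [MulAction G F] [MulAction G M] {o : EquivariantOrder G F M}
  {A B : Finset F} {c : F} {g : G} {m m' m₀ m₁ : M}

variable (o) in
/-- The restriction to `B` of the order assigned to a point. -/
def restrict (B : Finset F) (m : M) : B → B → Prop := fun a b => o.lt m a b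

theorem restrict_eq_restrict_iff :
    o.restrict B m = o.restrict B m' ↔ AgreeOn B (o.lt m) (o.lt m') := by
  simp only [restrict, funext_iff, eq_iff_iff, AgreeOn, Subtype.forall]

variable (o) in
/-- The points whose order agrees on `B` with that of `m₀`. -/
def cylinder (B : Finset F) (m₀ : M) : Set M := {m | AgreeOn B (o.lt m) (o.lt m₀)}

theorem mem_cylinder_self : m ∈ o.cylinder B m := AgreeOn.refl _ _

theorem cylinder_eq (h : AgreeOn B (o.lt m) (o.lt m')) : o.cylinder B m = o.cylinder B m' :=
  Set.ext fun _ => ⟨fun h' => h'.trans h, fun h' => h'.trans h.symm⟩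

theorem cylinder_anti (h : A ⊆ B) : o.cylinder B m ⊆ o.cylinder A m := fun _ h' => h'.mono h

theorem preimage_restrict_singleton : o.restrict B ⁻¹' {o.restrict B m} = o.cylinder B m :=
  Set.ext fun _ => restrict_eq_restrict_iff

theorem mem_cylinder_insert_iff (hc : c ∉ A) :
    m ∈ o.cylinder (insert c A) m₀ ↔
      m ∈ o.cylinder A m₀ ∧ rk (o.lt m) A c = rk (o.lt m₀) A c :=
  ⟨fun h => ⟨h.mono (Finset.subset_insert _ _),
    h.rk_eq (Finset.subset_insert _ _) (Finset.mem_insert_self _ _)⟩,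
    fun h => AgreeOn.insert_of_rk_eq hc h.1 h.2⟩

variable (o) in
/-- The points whose order agrees with that of `m₀` on `A` and in which some element of the orbit of
`c` under the stabilizer of `A` lies relative to `A` as `c` does at `m₀`. -/
def realiseEvent (A : Finset F) (c : F) (m₀ : M) : Set M :=
  {m ∈ o.cylinder A m₀ | ∃ g ∈ fixingSubgroup G (A : Set F), g • m ∈ o.cylinder (insert c A) m₀}

theorem cylinder_insert_subset_realiseEvent :
    o.cylinder (insert c A) m₀ ⊆ o.realiseEvent A c m₀ := fun m hm =>
  ⟨cylinder_anti (Finset.subset_insert _ _) hm, 1, one_mem _, by rwa [one_smul]⟩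

variable (o) in
/-- The part of `realiseEvent` where the element of the orbit of `c` can be chosen in `E`. -/
def realiseWithin (A : Finset F) (c : F) (m₀ : M) (E : Finset F) : Set M :=
  {m ∈ o.cylinder A m₀ |
    ∃ g ∈ fixingSubgroup G (A : Set F), g⁻¹ • c ∈ E ∧ g • m ∈ o.cylinder (insert c A) m₀}

theorem realiseWithin_mono : Monotone (o.realiseWithin A c m₀) :=
  fun _ _ hE _ ⟨hm, g, hg, hgE, h⟩ => ⟨hm, g, hg, hE hgE, h⟩

theorem iUnion_realiseWithin : ⋃ E, o.realiseWithin A c m₀ E = o.realiseEvent A c m₀ := by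
  refine Set.Subset.antisymm ?_ ?_
  · exact Set.iUnion_subset fun E m ⟨hm, g, hg, _, h⟩ => ⟨hm, g, hg, h⟩
  rintro m ⟨hm, g, hg, h⟩
  exact Set.mem_iUnion.2 ⟨{g⁻¹ • c}, hm, g, hg, Finset.mem_singleton_self _, h⟩

theorem mem_realiseWithin_of_agreeOn {E : Finset F} (h : AgreeOn (E ∪ A) (o.lt m) (o.lt m'))
    (hm : m ∈ o.realiseWithin A c m₀ E) : m' ∈ o.realiseWithin A c m₀ E := by
  obtain ⟨hmA, g, hg, hgE, hgm⟩ := hm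
  refine ⟨(h.symm.mono Finset.subset_union_right).trans hmA, g, hg, hgE, AgreeOn.trans ?_ hgm⟩
  exact (agreeOn_insert_smul_iff hg).2 (h.symm.mono
    (Finset.insert_subset (Finset.mem_union_left _ hgE) Finset.subset_union_right))

theorem smul_mem_cylinder_iff (hg : g ∈ stabilizer G B) (h : g • m₀ ∈ o.cylinder B m₁) :
    g • m ∈ o.cylinder B m₁ ↔ m ∈ o.cylinder B m₀ := by
  rw [← cylinder_eq h, cylinder, Set.mem_ofPred_eq]
  nth_rw 1 [← mem_stabilizer_iff.1 hg]
  exact agreeOn_smul_iff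

variable [MeasurableSpace M] {μ : Measure M}
  (hmeas : ∀ a b, MeasurableSet {m | o.lt m a b})
include hmeas

theorem measurable_restrict (B : Finset F) : Measurable (o.restrict B) :=
  measurable_pi_iff.2 fun a => measurable_pi_iff.2 fun b => measurableSet_setOfPred.1 (hmeas a b)

theorem measurableSet_of_agreeOn {s : Set M} (B : Finset F)
    (hs : ∀ m m', AgreeOn B (o.lt m) (o.lt m') → m ∈ s → m' ∈ s) : MeasurableSet s := by
  have heq : s = o.restrict B ⁻¹' (o.restrict B '' s) := by
    refine (Set.subset_preimage_image _ _).antisymm ?_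
    rintro m' ⟨m, hm, h⟩
    exact hs m m' (restrict_eq_restrict_iff.1 h) hm
  rw [heq]
  exact measurable_restrict hmeas B (Set.toFinite _).measurableSet

theorem measurableSet_cylinder (B : Finset F) (m₀ : M) : MeasurableSet (o.cylinder B m₀) :=
  measurableSet_of_agreeOn hmeas B fun _ _ h hm => h.symm.trans hm

theorem measurableSet_rk_eq (S : Finset F) (u : F) (i : ℕ) :
    MeasurableSet {m | rk (o.lt m) S u = i} :=
  measurableSet_of_agreeOn hmeas (insert u S) fun _ _ h hm =>
    (h.rk_eq (Finset.subset_insert _ _) (Finset.mem_insert_self _ _)).symm.trans hm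

theorem measurableSet_realiseWithin (A : Finset F) (c : F) (m₀ : M) (E : Finset F) :
    MeasurableSet (o.realiseWithin A c m₀ E) :=
  measurableSet_of_agreeOn hmeas (E ∪ A) fun _ _ => mem_realiseWithin_of_agreeOn

theorem measurableSet_realiseEvent [Countable F] (A : Finset F) (c : F) (m₀ : M) :
    MeasurableSet (o.realiseEvent A c m₀) := by
  rw [← iUnion_realiseWithin]
  exact MeasurableSet.iUnion (measurableSet_realiseWithin hmeas A c m₀)

theorem measureReal_eq_sum_restrict [IsFiniteMeasure μ] (B : Finset F) {s : Set M} :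
    μ.real s = ∑ x : B → B → Prop, μ.real (s ∩ o.restrict B ⁻¹' {x}) := by
  have hsum := sum_measureReal_preimage_singleton (μ := μ.restrict s) Finset.univ
    fun x _ => measurable_restrict hmeas B (measurableSet_singleton x)
  rw [Finset.coe_univ, Set.preimage_univ, measureReal_restrict_apply_univ] at hsum
  rw [← hsum]
  refine Finset.sum_congr rfl fun x _ => ?_
  rw [measureReal_restrict_apply (measurable_restrict hmeas B (measurableSet_singleton x)),
    Set.inter_comm]

variable [SMulInvariantMeasure G M μ] (H : o.IsHomogeneous)
include H

theorem IsHomogeneous.measureReal_cylinder_eq (B : Finset F) (m₁ m₂ : M) :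
    μ.real (o.cylinder B m₁) = μ.real (o.cylinder B m₂) := by
  obtain ⟨g, hg, h⟩ := H.transitive B m₁ m₂
  exact measureReal_eq_of_smul_mem_iff (measurableSet_cylinder hmeas B m₂) fun m =>
    smul_mem_cylinder_iff hg h

theorem IsHomogeneous.measureReal_cylinder [IsProbabilityMeasure μ] (B : Finset F) (m₀ : M) :
    μ.real (o.cylinder B m₀) = (#{x | x ∈ Set.range (o.restrict B)} : ℝ)⁻¹ := by
  have hfiber : ∀ x : B → B → Prop, μ.real (Set.univ ∩ o.restrict B ⁻¹' {x}) =
      if x ∈ Set.range (o.restrict B) then μ.real (o.cylinder B m₀) else 0 := by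
    intro x
    rw [Set.univ_inter]
    split_ifs with hx
    · obtain ⟨m, rfl⟩ := hx
      rw [preimage_restrict_singleton, H.measureReal_cylinder_eq hmeas B m m₀]
    · rw [Set.preimage_singleton_eq_empty.2 hx, measureReal_empty]
  refine eq_inv_of_mul_eq_one_right ?_
  rw [← probReal_univ (μ := μ), measureReal_eq_sum_restrict hmeas B (s := .univ),
    Finset.sum_congr rfl fun x _ => hfiber x, ← Finset.sum_filter, Finset.sum_const, nsmul_eq_mul]

theorem IsHomogeneous.measureReal_cylinder_pos [IsProbabilityMeasure μ] (B : Finset F) (m₀ : M) :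
    0 < μ.real (o.cylinder B m₀) := by
  rw [H.measureReal_cylinder hmeas B m₀, inv_pos, Nat.cast_pos, Finset.card_pos]
  exact ⟨o.restrict B m₀, by simp⟩

theorem IsHomogeneous.measureReal_cylinder_eq_card_gaps_mul [IsFiniteMeasure μ] (hc : c ∉ A)
    (m₀ : M) :
    μ.real (o.cylinder A m₀) = #(o.gaps A c m₀) * μ.real (o.cylinder (insert c A) m₀) := by
  have hcover : o.cylinder A m₀ =
      ⋃ p ∈ o.gaps A c m₀, o.cylinder A m₀ ∩ {m | rk (o.lt m) A c = p} := by
    ext m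
    simp only [Set.mem_iUnion, Set.mem_inter_iff, Set.mem_ofPred_eq, exists_prop,
      exists_eq_right_right']
    exact ⟨fun h => ⟨rk_mem_gaps h, h⟩, And.right⟩
  have hpiece : ∀ p ∈ o.gaps A c m₀, μ.real (o.cylinder A m₀ ∩ {m | rk (o.lt m) A c = p}) =
      μ.real (o.cylinder (insert c A) m₀) := by
    intro p hp
    obtain ⟨mp, hmp, rfl⟩ := mem_gaps.1 hp
    rw [H.measureReal_cylinder_eq hmeas (insert c A) m₀ mp, ← cylinder_eq hmp]
    exact congrArg μ.real (Set.ext fun m => (mem_cylinder_insert_iff hc).symm)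
  rw [hcover, measureReal_biUnion_finset, Finset.sum_congr rfl hpiece, Finset.sum_const,
    nsmul_eq_mul]
  · exact fun p _ p' _ hpp' =>
      Set.disjoint_left.2 fun m hm hm' => hpp' (hm.2.symm.trans hm'.2)
  · exact fun p _ => (measurableSet_cylinder hmeas A m₀).inter (measurableSet_rk_eq hmeas _ _ _)

end EquivariantOrder

end Measure

section BlockEvents

open MulAction

namespace EquivariantOrder

variable {G F M : Type*} [Group G] [MulAction G F] [MulAction G M] {o : EquivariantOrder G F M}
  {A : Finset F} {c : F} {g : G} {m m' : M}

theorem gaps_subset_gaps (h : AgreeOn A (o.lt m) (o.lt m')) : o.gaps A c m ⊆ o.gaps A c m' := by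
  intro p hp
  obtain ⟨x, hx, rfl⟩ := mem_gaps.1 hp
  exact rk_mem_gaps (hx.trans h)

theorem gaps_congr (h : AgreeOn A (o.lt m) (o.lt m')) : o.gaps A c m = o.gaps A c m' :=
  (gaps_subset_gaps h).antisymm (gaps_subset_gaps h.symm)

theorem gaps_smul (hg : g ∈ stabilizer G A) : o.gaps A (g • c) (g • m) = o.gaps A c m := by
  ext p
  simp only [mem_gaps]
  constructor
  · rintro ⟨x, hx, rfl⟩
    refine ⟨g⁻¹ • x, ?_, ?_⟩
    · simpa only [inv_smul_smul] using agreeOn_smul_of_mem_stabilizer (inv_mem hg) hx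
    · rw [← rk_smul_of_mem_stabilizer hg, smul_inv_smul]
  · rintro ⟨x, hx, rfl⟩
    exact ⟨g • x, agreeOn_smul_of_mem_stabilizer hg hx, rk_smul_of_mem_stabilizer hg x c⟩

end EquivariantOrder

namespace Block

open EquivariantOrder

variable {G F M : Type*} [Group G] [MulAction G F] [MulAction G M] {o : EquivariantOrder G F M}
  (D : Block o) {S : Finset F} {c u v : F} {g t : G} {m : M} {i k : ℕ}

/-- One if `r` lies above all gaps and zero otherwise. -/
def shift (r : F) : ℕ := if D.hi < D.pos r then 1 else 0

/-- The points at which the elements of `D.outer` have over `S` the ranks they have at `D.ref` after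
the elements of `D.inner` are replaced by `k` others. Both sides are increased by `D.shift r` in
order to avoid a subtraction, since `D.pos` counts one element `D.pt` of `D.inner`. -/
def outerEvent (S : Finset F) (k : ℕ) : Set M :=
  {m | ∀ r ∈ D.outer, rk (o.lt m) S r + D.shift r = D.pos r + k * D.shift r}

/-- The points at which `c` lies over the base as `D.pt` does at `D.ref`, up to the order of the
elements of the base that are neither below nor above all gaps. -/
def gapEvent (c : F) : Set M := {m ∈ D.outerEvent D.base 0 | rk (o.lt m) D.base c = D.gap}

/-- The points at which `u` has rank `i` in the domain of the block. -/
def placeEvent (u : F) (i : ℕ) : Set M := {m ∈ D.outerEvent D.dom 1 | rk (o.lt m) D.dom u = i}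

/-- The points at which `u` and `v` are consecutive in the domain enlarged by `c`, with `u` in the
position of `D.pt`. -/
def pairEvent (c u v : F) : Set M :=
  {m ∈ D.outerEvent (insert c D.dom) 2 |
    rk (o.lt m) (insert c D.dom) u = D.gap ∧ rk (o.lt m) (insert c D.dom) v = D.gap + 1}

theorem mem_outerEvent_insert_iff (hc : c ∉ S) (hS : D.outer ⊆ S) (hlo : D.lo ≤ rk (o.lt m) S c)
    (hhi : rk (o.lt m) S c ≤ D.hi + k) :
    m ∈ D.outerEvent (insert c S) (k + 1) ↔ m ∈ D.outerEvent S k := by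
  refine forall₂_congr fun r hr => ?_
  have hpos := (D.mem_outer.1 hr).2
  rw [rk_insert hc, shift, lt_iff_rk_le_rk (r := o.lt m) hc (hS hr)]
  split_ifs <;> omega

theorem rk_bounds_of_mem_outerEvent (hm : m ∈ D.outerEvent S k) (hS : D.outer ⊆ S)
    (hcard : #S + 1 = #D.dom + k) (hc : c ∈ S) (hc' : c ∉ D.outer) :
    D.lo ≤ rk (o.lt m) S c ∧ rk (o.lt m) S c + 1 ≤ D.hi + k := by
  have hlh := D.lo_lt_hi
  have hhi := D.hi_lt_card_dom
  have hck := rk_lt_card (r := o.lt m) hc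
  have hne : ∀ r ∈ D.outer, rk (o.lt m) S r ≠ rk (o.lt m) S c := fun r hr h =>
    hc' (injOn_rk (hS hr) hc h ▸ hr)
  constructor
  · by_contra! hlt
    obtain ⟨r, hr, hpos⟩ : ∃ r ∈ D.dom, D.pos r = rk (o.lt m) S c := exists_rk_eq (by omega)
    have hout := D.mem_outer.2 ⟨hr, Or.inl (hpos ▸ hlt)⟩
    have hrk := hm r hout
    rw [shift, if_neg (by omega)] at hrk
    exact hne r hout (by omega)
  · by_contra! hlt
    obtain ⟨r, hr, hpos⟩ : ∃ r ∈ D.dom, D.pos r = rk (o.lt m) S c + 1 - k :=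
      exists_rk_eq (by omega)
    have hout := D.mem_outer.2 ⟨hr, Or.inr (by omega)⟩
    have hrk := hm r hout
    rw [shift, if_pos (by omega)] at hrk
    exact hne r hout (by omega)

theorem mem_outerEvent_of_agreeOn {m' : M} (h : AgreeOn S (o.lt m) (o.lt m')) (hS : D.outer ⊆ S)
    (hm : m ∈ D.outerEvent S k) : m' ∈ D.outerEvent S k := fun r hr => by
  rw [← h.rk_eq subset_rfl (hS hr), hm r hr]

theorem smul_mem_outerEvent_iff (hg : g ∈ stabilizer G S)
    (hg' : g ∈ fixingSubgroup G (D.outer : Set F)) :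
    g • m ∈ D.outerEvent S k ↔ m ∈ D.outerEvent S k := by
  refine forall₂_congr fun r hr => ?_
  have hrk := rk_smul_of_mem_stabilizer (o := o) hg m r
  rw [(mem_fixingSubgroup_iff G).1 hg' r hr] at hrk
  rw [hrk]

theorem smul_mem_gapEvent_iff (hg : g ∈ stabilizer G D.base)
    (hg' : g ∈ fixingSubgroup G (D.outer : Set F)) :
    g • m ∈ D.gapEvent (g • c) ↔ m ∈ D.gapEvent c :=
  and_congr (D.smul_mem_outerEvent_iff hg hg') (by rw [rk_smul_of_mem_stabilizer hg])

theorem mem_fixingSubgroup_outer (ht : t ∈ fixingSubgroup G (D.base : Set F)) :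
    t ∈ fixingSubgroup G (D.outer : Set F) :=
  fixingSubgroup_antitone G F (Finset.coe_subset.2 D.outer_subset_base) ht

theorem smul_mem_gapEvent_iff_of_mem_fixingSubgroup
    (ht : t ∈ fixingSubgroup G (D.base : Set F)) : t • m ∈ D.gapEvent (t • c) ↔ m ∈ D.gapEvent c :=
  D.smul_mem_gapEvent_iff (mem_stabilizer_of_mem_fixingSubgroup ht) (D.mem_fixingSubgroup_outer ht)

theorem smul_mem_placeEvent_iff (hg : g ∈ D.group G) :
    g • m ∈ D.placeEvent (g • u) i ↔ m ∈ D.placeEvent u i :=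
  and_congr (D.smul_mem_outerEvent_iff hg.1 hg.2) (by rw [rk_smul_of_mem_stabilizer hg.1])

theorem smul_mem_pairEvent_iff (hg : g ∈ stabilizer G (insert c D.dom))
    (hg' : g ∈ fixingSubgroup G (D.outer : Set F)) :
    g • m ∈ D.pairEvent c (g • u) (g • v) ↔ m ∈ D.pairEvent c u v :=
  and_congr (D.smul_mem_outerEvent_iff hg hg')
    (by rw [rk_smul_of_mem_stabilizer hg, rk_smul_of_mem_stabilizer hg])

theorem gapEvent_pt : D.gapEvent D.pt = D.placeEvent D.pt D.gap := by
  ext m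
  have hrk : rk (o.lt m) D.dom D.pt = rk (o.lt m) D.base D.pt := rk_insert_self
  have hgap := Finset.mem_Icc.1 D.gap_mem_Icc
  refine (and_congr_left fun h => ?_).trans (and_congr_right' (by rw [hrk]))
  exact (D.mem_outerEvent_insert_iff D.pt_notMem D.outer_subset_base
    (h ▸ hgap.1) (h ▸ hgap.2)).symm

theorem smul_pt_notMem_dom (ht : t ∈ fixingSubgroup G (D.base : Set F)) (hne : t • D.pt ≠ D.pt) :
    t • D.pt ∉ D.dom := by
  rw [dom, Finset.mem_insert, not_or,
    mem_stabilizer_finset.1 (mem_stabilizer_of_mem_fixingSubgroup ht)]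
  exact ⟨hne, D.pt_notMem⟩

theorem gapEvent_inter_subset_pairEvent (hc : c ∉ D.dom) :
    D.gapEvent D.pt ∩ D.gapEvent c ⊆ D.pairEvent c D.pt c ∪ D.pairEvent c c D.pt := by
  rintro m ⟨hpt, hmc⟩
  have hgap := Finset.mem_Icc.1 D.gap_mem_Icc
  have hrk : rk (o.lt m) D.dom c = D.gap + if o.lt m D.pt c then 1 else 0 := by
    rw [dom, rk_insert D.pt_notMem, hmc.2]
  rw [gapEvent_pt] at hpt
  have hout : m ∈ D.outerEvent (insert c D.dom) 2 :=
    (D.mem_outerEvent_insert_iff hc D.outer_subset_dom (by omega)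
      (by rw [hrk]; split_ifs <;> omega)).2 hpt.1
  have hrk_c : rk (o.lt m) (insert c D.dom) c = D.gap + if o.lt m D.pt c then 1 else 0 := by
    rw [rk_insert_self, hrk]
  have hrk_pt : rk (o.lt m) (insert c D.dom) D.pt = D.gap + if o.lt m c D.pt then 1 else 0 := by
    rw [rk_insert hc, hpt.2]
  rcases trichotomous_of (o.lt m) D.pt c with h | h | h
  · refine Or.inl ⟨hout, ?_, ?_⟩
    · rw [hrk_pt, if_neg (asymm h), add_zero]
    · rw [hrk_c, if_pos h]
  · exact absurd (h ▸ D.pt_mem_dom) hc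
  · refine Or.inr ⟨hout, ?_, ?_⟩
    · rw [hrk_c, if_neg (asymm h), add_zero]
    · rw [hrk_pt, if_pos h]

theorem pairEvent_subset (hc : c ∉ D.dom) (hu : u ∈ D.dom) (hv : v ∈ D.dom) :
    D.pairEvent c u v ⊆
      (D.placeEvent u D.gap ∩ D.placeEvent v (D.gap + 1)) ∪
        (D.placeEvent u (D.gap - 1) ∩ D.placeEvent v D.gap) := by
  rintro m ⟨hm, hmu, hmv⟩
  have hbounds := D.rk_bounds_of_mem_outerEvent hm
    (D.outer_subset_dom.trans (Finset.subset_insert c D.dom))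
    (by rw [Finset.card_insert_of_notMem hc]) (Finset.mem_insert_self c D.dom)
    (fun h => hc (D.outer_subset_dom h))
  rw [rk_insert_self] at hbounds
  have hout := (D.mem_outerEvent_insert_iff hc D.outer_subset_dom hbounds.1 (by omega)).1 hm
  rw [rk_insert hc, lt_iff_rk_le_rk (r := o.lt m) hc hu] at hmu
  rw [rk_insert hc, lt_iff_rk_le_rk (r := o.lt m) hc hv] at hmv
  by_cases hle : rk (o.lt m) D.dom c ≤ rk (o.lt m) D.dom u
  · rw [if_pos hle] at hmu
    rw [if_pos (by split_ifs at hmv <;> omega)] at hmv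
    exact Or.inr ⟨⟨hout, by omega⟩, ⟨hout, by omega⟩⟩
  · rw [if_neg hle] at hmu
    refine Or.inl ⟨⟨hout, by omega⟩, ⟨hout, ?_⟩⟩
    split_ifs at hmv <;> omega

end Block

end BlockEvents

section BlockTransport

open MulAction

namespace Block

open EquivariantOrder

variable {G F M : Type*} [Group G] [MulAction G F] [MulAction G M] {o : EquivariantOrder G F M}
  (D : Block o) {c e e' : F} {g t : G} {m : M}

theorem mem_stabilizer_base (hg : g ∈ stabilizer G D.dom) (hpt : g • D.pt = D.pt) :
    g ∈ stabilizer G D.base := by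
  refine mem_stabilizer_finset.2 fun b => ?_
  have hdom := mem_stabilizer_finset.1 hg b
  have hb : g • b = D.pt ↔ b = D.pt := by
    conv_lhs => rw [← hpt, (MulAction.injective g).eq_iff]
  rw [dom, Finset.mem_insert, Finset.mem_insert, hb] at hdom
  have hnot := D.pt_notMem
  grind

theorem exists_smul_ref (H : o.IsHomogeneous) (hm : m ∈ D.gapEvent D.pt) :
    ∃ g ∈ stabilizer G D.base, g ∈ fixingSubgroup G (D.outer : Set F) ∧ g • D.pt = D.pt ∧
      AgreeOn D.base (o.lt (g • D.ref)) (o.lt m) := by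
  obtain ⟨g, hg, h⟩ := H.transitive D.dom D.ref m
  rw [gapEvent_pt] at hm
  have hpt : g • D.pt = D.pt := smul_eq_of_rk_eq hg h D.pt_mem_dom (hm.2.trans D.pos_pt.symm)
  refine ⟨g, D.mem_stabilizer_base hg hpt, (mem_fixingSubgroup_iff G).2 fun r hr => ?_, hpt,
    h.mono (Finset.subset_insert _ _)⟩
  have hrk := hm.1 r hr
  rw [one_mul, add_left_inj] at hrk
  exact smul_eq_of_rk_eq hg h (D.outer_subset_dom hr) hrk

theorem gaps_eq_of_mem_gapEvent (H : o.IsHomogeneous) (hm : m ∈ D.gapEvent D.pt) :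
    o.gaps D.base D.pt m = o.gaps D.base D.pt D.ref := by
  obtain ⟨g, hg, -, hpt, h⟩ := D.exists_smul_ref H hm
  rw [← gaps_congr h, ← gaps_smul (c := D.pt) (m := D.ref) hg, hpt]

theorem gaps_smul_pt_eq_of_mem_gapEvent (H : o.IsHomogeneous) (hm : m ∈ D.gapEvent D.pt)
    (ht : t ∈ fixingSubgroup G (D.base : Set F)) :
    o.gaps D.base (t • D.pt) m = o.gaps D.base D.pt D.ref := by
  rw [← gaps_congr (agreeOn_smul_of_mem_fixingSubgroup ht m),
    gaps_smul (mem_stabilizer_of_mem_fixingSubgroup ht), D.gaps_eq_of_mem_gapEvent H hm]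

theorem smul_mem_inner_of_ne (hg : g ∈ stabilizer G (insert c D.dom))
    (hg' : g ∈ fixingSubgroup G (D.outer : Set F)) (he : e ∈ insert c D.inner)
    (hne : g • e ≠ c) : g • e ∈ D.inner := by
  have hout : g • e ∉ D.outer := fun h => by
    have heq : g • e = e := MulAction.injective g ((mem_fixingSubgroup_iff G).1 hg' _ h)
    rw [heq] at h hne
    exact (Finset.mem_sdiff.1 h).2 (Finset.mem_of_mem_insert_of_ne he hne)
  have hdom : g • e ∈ insert c D.dom :=
    (mem_stabilizer_finset.1 hg e).2 (Finset.insert_subset_insert c D.inner_subset_dom he)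
  by_contra h
  exact hout (Finset.mem_sdiff.2 ⟨Finset.mem_of_mem_insert_of_ne hdom hne, h⟩)

theorem mem_outerEvent_insert_smul_pt (H : o.IsHomogeneous)
    (ht : t ∈ fixingSubgroup G (D.base : Set F)) (hne : t • D.pt ≠ D.pt)
    {d x : M} (hd : d ∈ D.gapEvent D.pt) (hx : AgreeOn D.base (o.lt x) (o.lt d)) :
    x ∈ D.outerEvent (insert (t • D.pt) D.dom) 2 := by
  have hgap : ∀ s ∈ fixingSubgroup G (D.base : Set F),
      D.lo ≤ rk (o.lt x) D.base (s • D.pt) ∧ rk (o.lt x) D.base (s • D.pt) ≤ D.hi := fun s hs =>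
    Finset.mem_Icc.1 (D.gaps_subset
      (D.gaps_smul_pt_eq_of_mem_gapEvent H hd hs ▸ rk_mem_gaps hx))
  have hpt := hgap 1 (one_mem _)
  have ht' := hgap t ht
  rw [one_smul] at hpt
  have hbase := D.mem_outerEvent_of_agreeOn hx.symm D.outer_subset_base hd.1
  have hdom := (D.mem_outerEvent_insert_iff D.pt_notMem D.outer_subset_base hpt.1 hpt.2).2 hbase
  have hrk : rk (o.lt x) D.dom (t • D.pt) =
      rk (o.lt x) D.base (t • D.pt) + if o.lt x D.pt (t • D.pt) then 1 else 0 :=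
    rk_insert D.pt_notMem _
  exact (D.mem_outerEvent_insert_iff (D.smul_pt_notMem_dom ht hne) D.outer_subset_dom
    (by omega) (by rw [hrk]; split_ifs <;> omega)).2 hdom

/-- A fourth gap `p` lets us move `t • D.pt` away from the two consecutive positions in question:
the elements that then occupy these positions lie in `D.inner`. -/
theorem exists_smul_mem_inner (H : o.IsHomogeneous) (hgaps : 4 ≤ #(o.gaps D.base D.pt D.ref))
    (ht : t ∈ fixingSubgroup G (D.base : Set F)) (hne : t • D.pt ≠ D.pt)
    (he : e ∈ insert (t • D.pt) D.inner) (he' : e' ∈ insert (t • D.pt) D.inner)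
    {d : M} (hd : d ∈ D.gapEvent D.pt) (hd' : d ∈ D.pairEvent (t • D.pt) e e') :
    ∃ g ∈ stabilizer G (insert (t • D.pt) D.dom), g ∈ fixingSubgroup G (D.outer : Set F) ∧
      g • e ∈ D.inner ∧ g • e' ∈ D.inner := by
  obtain ⟨p, hp, hp'⟩ := Finset.exists_mem_notMem_of_card_lt_card
    (Finset.card_le_three.trans_lt hgaps : #{D.gap - 1, D.gap, D.gap + 1} < _)
  simp only [Finset.mem_insert, Finset.mem_singleton, not_or] at hp'
  rw [← D.gaps_smul_pt_eq_of_mem_gapEvent H hd ht] at hp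
  obtain ⟨x, hx, hxp⟩ := mem_gaps.1 hp
  have hinner := Finset.insert_subset_insert (t • D.pt) D.inner_subset_dom
  have hrk_x : rk (o.lt x) (insert (t • D.pt) D.dom) (t • D.pt) =
      p + if o.lt x D.pt (t • D.pt) then 1 else 0 := by
    rw [rk_insert_self, dom, rk_insert D.pt_notMem, hxp]
  obtain ⟨g, hg, h⟩ := H.transitive (insert (t • D.pt) D.dom) d x
  have hg' : g ∈ fixingSubgroup G (D.outer : Set F) := (mem_fixingSubgroup_iff G).2 fun r hr =>
    smul_eq_of_rk_eq hg h (Finset.mem_insert_of_mem (D.outer_subset_dom hr)) (by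
      have hrk := D.mem_outerEvent_insert_smul_pt H ht hne hd hx r hr
      rwa [← hd'.1 r hr, add_left_inj] at hrk)
  refine ⟨g, hg, hg', D.smul_mem_inner_of_ne hg hg' he fun heq => ?_,
    D.smul_mem_inner_of_ne hg hg' he' fun heq => ?_⟩
  · have hrk := rk_smul_of_agreeOn hg h (hinner he)
    rw [heq, hrk_x, hd'.2.1] at hrk
    split_ifs at hrk <;> omega
  · have hrk := rk_smul_of_agreeOn hg h (hinner he')
    rw [heq, hrk_x, hd'.2.2] at hrk
    split_ifs at hrk <;> omega

theorem card_gaps_le_card_inner : #(o.gaps D.base D.pt D.ref) ≤ #D.inner := by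
  refine (Finset.card_le_card fun p hp => ?_).trans (Finset.card_image_le (f := D.pos))
  have hp' := Finset.mem_Icc.1 (D.gaps_subset hp)
  obtain ⟨u, hu, rfl⟩ : ∃ u ∈ D.dom, D.pos u = p := exists_rk_eq (hp'.2.trans_lt D.hi_lt_card_dom)
  exact Finset.mem_image_of_mem _ (D.mem_inner.2 ⟨hu, hp'⟩)

variable (G) in
/-- The points at which some element of the orbit of `D.pt` under the stabilizer of the base lies
over the base as `D.pt` does at `D.ref`, in the sense of `gapEvent`. -/
def fillEvent : Set M := {m | ∃ t ∈ fixingSubgroup G (D.base : Set F), t • m ∈ D.gapEvent D.pt}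

theorem fillEvent_eq_biUnion :
    D.fillEvent G =
      ⋃ c ∈ orbit (fixingSubgroup G (D.base : Set F)) D.pt, D.gapEvent c := by
  ext m
  simp only [fillEvent, Set.mem_ofPred_eq, Set.mem_iUnion, exists_prop, orbit, Set.exists_range_iff]
  constructor
  · rintro ⟨t, ht, h⟩
    refine ⟨⟨t⁻¹, inv_mem ht⟩, ?_⟩
    rw [← D.smul_mem_gapEvent_iff_of_mem_fixingSubgroup ht]
    simpa only [Subgroup.mk_smul, smul_inv_smul] using h
  · rintro ⟨⟨t, ht⟩, h⟩
    refine ⟨t⁻¹, inv_mem ht, ?_⟩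
    rw [← D.smul_mem_gapEvent_iff_of_mem_fixingSubgroup ht, smul_inv_smul]
    exact h

theorem smul_mem_fillEvent (hg : g ∈ stabilizer G D.base)
    (hg' : g ∈ fixingSubgroup G (D.outer : Set F)) (hpt : g • D.pt = D.pt)
    (hm : m ∈ D.fillEvent G) : g • m ∈ D.fillEvent G := by
  obtain ⟨t, ht, h⟩ := hm
  refine ⟨g * t * g⁻¹, (mem_fixingSubgroup_iff G).2 fun b hb => ?_, ?_⟩
  · have hb' : g⁻¹ • b ∈ D.base := (mem_stabilizer_finset.1 (inv_mem hg) b).2 hb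
    rw [mul_smul, mul_smul, (mem_fixingSubgroup_iff G).1 ht _ hb', smul_inv_smul]
  · rw [mul_smul, mul_smul, inv_smul_smul]
    exact hpt ▸ (D.smul_mem_gapEvent_iff hg hg').2 h

theorem smul_mem_fillEvent_iff (hg : g ∈ stabilizer G D.base)
    (hg' : g ∈ fixingSubgroup G (D.outer : Set F)) (hpt : g • D.pt = D.pt) :
    g • m ∈ D.fillEvent G ↔ m ∈ D.fillEvent G :=
  ⟨fun h => inv_smul_smul g m ▸
    D.smul_mem_fillEvent (inv_mem hg) (inv_mem hg') (inv_smul_eq_iff.2 hpt.symm) h,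
    D.smul_mem_fillEvent hg hg' hpt⟩

theorem exists_smul_ref_of_mem_fillEvent (H : o.IsHomogeneous) (hm : m ∈ D.fillEvent G) :
    ∃ g ∈ stabilizer G D.base, g ∈ fixingSubgroup G (D.outer : Set F) ∧ g • D.pt = D.pt ∧
      AgreeOn D.base (o.lt (g • D.ref)) (o.lt m) := by
  obtain ⟨t, ht, h⟩ := hm
  obtain ⟨g, hg, hg', hpt, hagree⟩ := D.exists_smul_ref H h
  exact ⟨g, hg, hg', hpt, hagree.trans (agreeOn_smul_of_mem_fixingSubgroup ht m)⟩

theorem ref_mem_gapEvent : D.ref ∈ D.gapEvent D.pt := by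
  rw [gapEvent_pt]
  exact ⟨fun r _ => by rw [one_mul]; rfl, D.pos_pt⟩

theorem gapEvent_pt_inter_cylinder :
    D.gapEvent D.pt ∩ o.cylinder D.base D.ref = o.cylinder D.dom D.ref := by
  ext m
  rw [dom, mem_cylinder_insert_iff D.pt_notMem, Set.inter_comm]
  refine and_congr_right fun h => ⟨And.right, fun hrk => ⟨?_, hrk⟩⟩
  exact D.mem_outerEvent_of_agreeOn (AgreeOn.symm h) D.outer_subset_base D.ref_mem_gapEvent.1

theorem fillEvent_inter_cylinder_subset :
    D.fillEvent G ∩ o.cylinder D.base D.ref ⊆ o.realiseEvent D.base D.pt D.ref := by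
  rintro m ⟨⟨t, ht, h⟩, hm⟩
  exact ⟨hm, t, ht, D.gapEvent_pt_inter_cylinder.subset
    ⟨h, (agreeOn_smul_of_mem_fixingSubgroup ht m).trans hm⟩⟩

end Block

end BlockTransport

section BlockMeasure

open MulAction

namespace Block

open EquivariantOrder

variable {G F M : Type*} [Group G] [MulAction G F] [MulAction G M] {o : EquivariantOrder G F M}
  (D : Block o) {S : Finset F} {c c₁ c₂ e e' u v : F} {t : G}

section Measurable

variable [MeasurableSpace M] (hmeas : ∀ a b, MeasurableSet {m | o.lt m a b})
include hmeas

theorem measurableSet_outerEvent (hS : D.outer ⊆ S) (k : ℕ) : MeasurableSet (D.outerEvent S k) :=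
  measurableSet_of_agreeOn hmeas S fun _ _ h => D.mem_outerEvent_of_agreeOn h hS

theorem measurableSet_gapEvent (c : F) : MeasurableSet (D.gapEvent c) :=
  (D.measurableSet_outerEvent hmeas D.outer_subset_base 0).inter (measurableSet_rk_eq hmeas _ _ _)

theorem measurableSet_placeEvent (u : F) (i : ℕ) : MeasurableSet (D.placeEvent u i) :=
  (D.measurableSet_outerEvent hmeas D.outer_subset_dom 1).inter (measurableSet_rk_eq hmeas _ _ _)

theorem measurableSet_pairEvent (c u v : F) : MeasurableSet (D.pairEvent c u v) :=
  (D.measurableSet_outerEvent hmeas (D.outer_subset_dom.trans (Finset.subset_insert c _)) 2).inter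
    ((measurableSet_rk_eq hmeas _ _ _).inter (measurableSet_rk_eq hmeas _ _ _))

theorem measurableSet_fillEvent [Countable F] : MeasurableSet (D.fillEvent G) := by
  rw [fillEvent_eq_biUnion]
  exact MeasurableSet.biUnion (Set.to_countable _) fun c _ => D.measurableSet_gapEvent hmeas c

end Measurable

variable [MeasurableSpace M] {μ : Measure M} [SMulInvariantMeasure G M μ]
  (hmeas : ∀ a b, MeasurableSet {m | o.lt m a b}) (H : o.IsHomogeneous)
include hmeas H

theorem measureReal_placeEvent_inter_eq {u' v' : F} (hu : u ∈ D.inner) (hv : v ∈ D.inner)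
    (huv : u ≠ v) (hu' : u' ∈ D.inner) (hv' : v' ∈ D.inner) (huv' : u' ≠ v') (i j : ℕ) :
    μ.real (D.placeEvent u i ∩ D.placeEvent v j) =
      μ.real (D.placeEvent u' i ∩ D.placeEvent v' j) := by
  obtain ⟨g, hg, rfl, rfl⟩ := D.exists_smul_pair H hu hv huv hu' hv' huv'
  exact measureReal_eq_of_smul_mem_iff
    ((D.measurableSet_placeEvent hmeas _ _).inter (D.measurableSet_placeEvent hmeas _ _))
    fun m => and_congr (D.smul_mem_placeEvent_iff hg) (D.smul_mem_placeEvent_iff hg)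

theorem measureReal_placeEvent_eq (hu : u ∈ D.inner) (hv : v ∈ D.inner) (i : ℕ) :
    μ.real (D.placeEvent u i) = μ.real (D.placeEvent v i) := by
  rcases eq_or_ne u v with rfl | huv
  · rfl
  obtain ⟨g, hg, rfl, -⟩ := D.exists_smul_pair H hu hv huv hv hu huv.symm
  exact measureReal_eq_of_smul_mem_iff (D.measurableSet_placeEvent hmeas _ _)
    fun m => D.smul_mem_placeEvent_iff hg

variable [IsFiniteMeasure μ]

theorem measureReal_outerEvent_le :
    μ.real (D.outerEvent D.dom 1) ≤ #D.inner * μ.real (D.gapEvent D.pt) := by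
  have hcover : D.outerEvent D.dom 1 ⊆ ⋃ u ∈ D.inner, D.placeEvent u D.gap := by
    intro m hm
    have hgap := Finset.mem_Icc.1 D.gap_mem_Icc
    obtain ⟨u, hu, hrk⟩ : ∃ u ∈ D.dom, rk (o.lt m) D.dom u = D.gap :=
      exists_rk_eq (hgap.2.trans_lt D.hi_lt_card_dom)
    refine Set.mem_iUnion₂.2 ⟨u, by_contra fun hin => ?_, hm, hrk⟩
    have hout : u ∈ D.outer := Finset.mem_sdiff.2 ⟨hu, hin⟩
    have hpos := hm u hout
    have hpos' := (D.mem_outer.1 hout).2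
    omega
  calc μ.real (D.outerEvent D.dom 1) ≤ μ.real (⋃ u ∈ D.inner, D.placeEvent u D.gap) :=
        measureReal_mono hcover (measure_ne_top _ _)
    _ ≤ ∑ u ∈ D.inner, μ.real (D.placeEvent u D.gap) := measureReal_biUnion_finset_le _ _
    _ = #D.inner * μ.real (D.gapEvent D.pt) := by
        rw [Finset.sum_congr rfl fun u hu =>
          D.measureReal_placeEvent_eq hmeas H hu D.pt_mem_inner D.gap,
          Finset.sum_const, nsmul_eq_mul, gapEvent_pt]

theorem card_offDiag_mul_measureReal_le (hu : u ∈ D.inner) (hv : v ∈ D.inner) (huv : u ≠ v)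
    (i j : ℕ) :
    #D.inner.offDiag * μ.real (D.placeEvent u i ∩ D.placeEvent v j) ≤
      μ.real (D.outerEvent D.dom 1) := by
  have hdisj : Set.PairwiseDisjoint (D.inner.offDiag : Set (F × F))
      fun p => D.placeEvent p.1 i ∩ D.placeEvent p.2 j := by
    rintro p hp q hq hpq
    have hp' := Finset.mem_offDiag.1 hp
    have hq' := Finset.mem_offDiag.1 hq
    refine Set.disjoint_left.2 fun m hmp hmq => hpq (Prod.ext ?_ ?_)
    · exact injOn_rk (D.inner_subset_dom hp'.1) (D.inner_subset_dom hq'.1)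
        (hmp.1.2.trans hmq.1.2.symm)
    · exact injOn_rk (D.inner_subset_dom hp'.2.1) (D.inner_subset_dom hq'.2.1)
        (hmp.2.2.trans hmq.2.2.symm)
  calc #D.inner.offDiag * μ.real (D.placeEvent u i ∩ D.placeEvent v j)
      = ∑ p ∈ D.inner.offDiag, μ.real (D.placeEvent p.1 i ∩ D.placeEvent p.2 j) := by
        rw [← nsmul_eq_mul, ← Finset.sum_const]
        refine Finset.sum_congr rfl fun p hp => ?_
        have hp' := Finset.mem_offDiag.1 hp
        exact D.measureReal_placeEvent_inter_eq hmeas H hu hv huv hp'.1 hp'.2.1 hp'.2.2 i j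
    _ = μ.real (⋃ p ∈ D.inner.offDiag, D.placeEvent p.1 i ∩ D.placeEvent p.2 j) :=
        (measureReal_biUnion_finset hdisj fun p _ =>
          (D.measurableSet_placeEvent hmeas _ _).inter (D.measurableSet_placeEvent hmeas _ _)).symm
    _ ≤ μ.real (D.outerEvent D.dom 1) :=
        measureReal_mono (Set.iUnion₂_subset fun p _ m hm => hm.1.1)

theorem card_offDiag_mul_measureReal_pairEvent_le (hc : c ∉ D.dom) (hu : u ∈ D.inner)
    (hv : v ∈ D.inner) (huv : u ≠ v) :
    #D.inner.offDiag * μ.real (D.pairEvent c u v) ≤ 2 * μ.real (D.outerEvent D.dom 1) := by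
  have hle := (measureReal_mono (μ := μ) (D.pairEvent_subset hc (D.inner_subset_dom hu)
    (D.inner_subset_dom hv))).trans (measureReal_union_le _ _)
  refine (mul_le_mul_of_nonneg_left hle (Nat.cast_nonneg _)).trans ?_
  rw [mul_add, two_mul]
  exact add_le_add (D.card_offDiag_mul_measureReal_le hmeas H hu hv huv _ _)
    (D.card_offDiag_mul_measureReal_le hmeas H hu hv huv _ _)

theorem card_offDiag_mul_measureReal_inter_pairEvent_le
    (hgaps : 4 ≤ #(o.gaps D.base D.pt D.ref)) (ht : t ∈ fixingSubgroup G (D.base : Set F))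
    (hne : t • D.pt ≠ D.pt) (he : e ∈ insert (t • D.pt) D.inner)
    (he' : e' ∈ insert (t • D.pt) D.inner) (hee' : e ≠ e') :
    #D.inner.offDiag * μ.real (D.gapEvent D.pt ∩ D.pairEvent (t • D.pt) e e') ≤
      2 * μ.real (D.outerEvent D.dom 1) := by
  rcases (D.gapEvent D.pt ∩ D.pairEvent (t • D.pt) e e').eq_empty_or_nonempty with
    h | ⟨d, hd, hd'⟩
  · rw [h, measureReal_empty, mul_zero]
    positivity
  obtain ⟨g, hg, hg', hu, hv⟩ := D.exists_smul_mem_inner H hgaps ht hne he he' hd hd'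
  have heq : μ.real (D.pairEvent (t • D.pt) e e') =
      μ.real (D.pairEvent (t • D.pt) (g • e) (g • e')) :=
    measureReal_eq_of_smul_mem_iff (D.measurableSet_pairEvent hmeas _ _ _) fun m =>
      D.smul_mem_pairEvent_iff hg hg'
  calc #D.inner.offDiag * μ.real (D.gapEvent D.pt ∩ D.pairEvent (t • D.pt) e e')
      ≤ #D.inner.offDiag * μ.real (D.pairEvent (t • D.pt) (g • e) (g • e')) := by
        rw [← heq]
        exact mul_le_mul_of_nonneg_left
          (measureReal_mono Set.inter_subset_right (measure_ne_top _ _)) (Nat.cast_nonneg _)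
    _ ≤ 2 * μ.real (D.outerEvent D.dom 1) :=
        D.card_offDiag_mul_measureReal_pairEvent_le hmeas H (D.smul_pt_notMem_dom ht hne) hu hv
          ((MulAction.injective g).ne hee')

theorem measureReal_gapEvent_pt_inter_le (hgaps : 4 ≤ #(o.gaps D.base D.pt D.ref))
    (ht : t ∈ fixingSubgroup G (D.base : Set F)) (hne : t • D.pt ≠ D.pt) :
    (#D.inner - 1) * μ.real (D.gapEvent D.pt ∩ D.gapEvent (t • D.pt)) ≤
      4 * μ.real (D.gapEvent D.pt) := by
  have hpt : D.pt ∈ insert (t • D.pt) D.inner := Finset.mem_insert_of_mem D.pt_mem_inner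
  have htpt : t • D.pt ∈ insert (t • D.pt) D.inner := Finset.mem_insert_self _ _
  have hcover : D.gapEvent D.pt ∩ D.gapEvent (t • D.pt) ⊆
      D.gapEvent D.pt ∩ D.pairEvent (t • D.pt) D.pt (t • D.pt) ∪
        D.gapEvent D.pt ∩ D.pairEvent (t • D.pt) (t • D.pt) D.pt := by
    rw [← Set.inter_union_distrib_left]
    exact Set.subset_inter Set.inter_subset_left
      (D.gapEvent_inter_subset_pairEvent (D.smul_pt_notMem_dom ht hne))
  have hle := (measureReal_mono (μ := μ) hcover).trans (measureReal_union_le _ _)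
  have h₁ := D.card_offDiag_mul_measureReal_inter_pairEvent_le (μ := μ) hmeas H hgaps ht hne hpt
    htpt hne.symm
  have h₂ := D.card_offDiag_mul_measureReal_inter_pairEvent_le (μ := μ) hmeas H hgaps ht hne htpt
    hpt hne
  have hout := D.measureReal_outerEvent_le (μ := μ) hmeas H
  have hpos : (0 : ℝ) < #D.inner := Nat.cast_pos.2 (Finset.card_pos.2 ⟨_, D.pt_mem_inner⟩)
  have hoff : (#D.inner.offDiag : ℝ) = #D.inner * (#D.inner - 1) := by
    rw [Finset.offDiag_card, Nat.cast_sub (Nat.le_mul_self _), Nat.cast_mul, mul_sub_one]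
  refine le_of_mul_le_mul_left ?_ hpos
  rw [← mul_assoc, ← hoff]
  linarith [mul_le_mul_of_nonneg_left hle (Nat.cast_nonneg (α := ℝ) #D.inner.offDiag)]

omit [IsFiniteMeasure μ] H in
theorem measureReal_gapEvent_eq (hc : c ∈ orbit (fixingSubgroup G (D.base : Set F)) D.pt) :
    μ.real (D.gapEvent c) = μ.real (D.gapEvent D.pt) := by
  obtain ⟨⟨t, ht⟩, rfl⟩ := hc
  exact (measureReal_eq_of_smul_mem_iff (D.measurableSet_gapEvent hmeas _) fun m =>
    D.smul_mem_gapEvent_iff_of_mem_fixingSubgroup ht).symm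

theorem measureReal_gapEvent_inter_le (hgaps : 4 ≤ #(o.gaps D.base D.pt D.ref))
    (hc₁ : c₁ ∈ orbit (fixingSubgroup G (D.base : Set F)) D.pt)
    (hc₂ : c₂ ∈ orbit (fixingSubgroup G (D.base : Set F)) D.pt) (hne : c₁ ≠ c₂) :
    (#D.inner - 1) * μ.real (D.gapEvent c₁ ∩ D.gapEvent c₂) ≤ 4 * μ.real (D.gapEvent D.pt) := by
  obtain ⟨⟨t, ht⟩, rfl⟩ := hc₁
  obtain ⟨⟨s, hs⟩, rfl⟩ := hc₂
  simp only [Subgroup.mk_smul] at hne ⊢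
  have hts := mul_mem (inv_mem ht) hs
  have heq : μ.real (D.gapEvent D.pt ∩ D.gapEvent ((t⁻¹ * s) • D.pt)) =
      μ.real (D.gapEvent (t • D.pt) ∩ D.gapEvent (s • D.pt)) := by
    refine measureReal_eq_of_smul_mem_iff (g := t)
      ((D.measurableSet_gapEvent hmeas _).inter (D.measurableSet_gapEvent hmeas _)) fun m =>
        and_congr (D.smul_mem_gapEvent_iff_of_mem_fixingSubgroup ht) ?_
    rw [← D.smul_mem_gapEvent_iff_of_mem_fixingSubgroup ht (c := (t⁻¹ * s) • D.pt), mul_smul,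
      smul_inv_smul]
  rw [← heq]
  refine D.measureReal_gapEvent_pt_inter_le hmeas H hgaps hts fun h => hne ?_
  rw [mul_smul, inv_smul_eq_iff] at h
  exact h.symm

end Block

end BlockMeasure

section FillEstimate

open MulAction

variable {G F M : Type*} [Group G] [MulAction G F] [MulAction G M] {o : EquivariantOrder G F M}
  {A : Finset F} {c : F} {m m₀ : M} {n : ℕ}

namespace EquivariantOrder

namespace IsHomogeneous

variable (H : o.IsHomogeneous)
include H

theorem exists_rk_mem_orbit_eq {P : Finset ℕ} (hP : P ⊆ o.gaps A c m₀) :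
    ∃ m, AgreeOn A (o.lt m) (o.lt m₀) ∧
      ∀ p ∈ P, ∃ c' ∈ orbit (fixingSubgroup G (A : Set F)) c, rk (o.lt m) A c' = p := by
  induction P using Finset.induction_on with
  | empty => exact ⟨m₀, AgreeOn.refl _ _, fun _ hp => absurd hp (Finset.notMem_empty _)⟩
  | insert p P _ ih =>
    rw [Finset.insert_subset_iff] at hP
    obtain ⟨m, hmA, hmP⟩ := ih hP.2
    obtain ⟨mp, hmp, hmpp⟩ := mem_gaps.1 hP.1
    have : Nonempty F := ⟨c⟩
    choose! f hf hfr using hmP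
    obtain ⟨m', g, hg, hm', hgm'⟩ := H.amalgamation A (A ∪ P.image f) Finset.subset_union_left c
      m mp (hmA.trans hmp.symm)
    refine ⟨m', (hm'.mono Finset.subset_union_left).trans hmA, fun p' hp' => ?_⟩
    rcases Finset.mem_insert.1 hp' with rfl | hp'
    · refine ⟨g⁻¹ • c, ⟨⟨g⁻¹, inv_mem hg⟩, rfl⟩, ?_⟩
      rw [← rk_smul_of_mem_stabilizer (mem_stabilizer_of_mem_fixingSubgroup hg), smul_inv_smul,
        hgm'.rk_eq (Finset.subset_insert _ _) (Finset.mem_insert_self _ _), hmpp]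
    · refine ⟨f p', hf p' hp', ?_⟩
      rw [hm'.rk_eq Finset.subset_union_left
        (Finset.mem_union_right _ (Finset.mem_image_of_mem f hp')), hfr p' hp']

theorem exists_card_eq_subset_orbit (hn : n ≤ #(o.gaps A c m₀)) :
    ∃ E : Finset F, #E = n ∧ (E : Set F) ⊆ orbit (fixingSubgroup G (A : Set F)) c := by
  obtain ⟨P, hP, rfl⟩ := Finset.exists_subset_card_eq hn
  obtain ⟨m, -, hm⟩ := H.exists_rk_mem_orbit_eq hP
  have : Nonempty F := ⟨c⟩
  choose! f hf hfr using hm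
  refine ⟨P.image f, Finset.card_image_of_injOn fun p hp q hq hpq => ?_, ?_⟩
  · rw [← hfr p hp, ← hfr q hq, hpq]
  · rw [Finset.coe_image]
    exact Set.image_subset_iff.2 hf

end IsHomogeneous

end EquivariantOrder

namespace Block

open EquivariantOrder

theorem exists_base_eq (m₀ : M) (hc : c ∉ A) (hgaps : 3 ≤ #(o.gaps A c m₀)) :
    ∃ D : Block o, D.base = A ∧ D.pt = c ∧ D.ref = m₀ := by
  have hne : (o.gaps A c m₀).Nonempty := Finset.card_pos.1 (by omega)
  obtain ⟨q, hq, hq'⟩ := Finset.exists_mem_notMem_of_card_lt_card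
    (Finset.card_le_two.trans_lt hgaps :
      #{(o.gaps A c m₀).min' hne, (o.gaps A c m₀).max' hne} < _)
  simp only [Finset.mem_insert, Finset.mem_singleton, not_or] at hq'
  exact ⟨{
    base := A
    pt := c
    ref := m₀
    lo := (o.gaps A c m₀).min' hne
    hi := (o.gaps A c m₀).max' hne
    pt_notMem := hc
    lo_mem_gaps := Finset.min'_mem _ _
    hi_mem_gaps := Finset.max'_mem _ _
    exists_mid := ⟨q, hq, (Finset.min'_le _ _ hq).lt_of_ne' hq'.1,
      (Finset.le_max' _ _ hq).lt_of_ne hq'.2⟩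
    gaps_subset := fun p hp => Finset.mem_Icc.2 ⟨Finset.min'_le _ _ hp, Finset.le_max' _ _ hp⟩ },
    rfl, rfl, rfl⟩

variable (D : Block o) [MeasurableSpace M] {μ : Measure M} [SMulInvariantMeasure G M μ]
  (hmeas : ∀ a b, MeasurableSet {m | o.lt m a b}) (H : o.IsHomogeneous)
include hmeas H

theorem measureReal_fillEvent_inter_cylinder [Countable F] (hm : m ∈ D.fillEvent G) :
    μ.real (D.fillEvent G ∩ o.cylinder D.base m) =
      μ.real (D.fillEvent G ∩ o.cylinder D.base D.ref) := by
  obtain ⟨g, hg, hg', hpt, h⟩ := D.exists_smul_ref_of_mem_fillEvent H hm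
  exact (measureReal_eq_of_smul_mem_iff
    ((D.measurableSet_fillEvent hmeas).inter (measurableSet_cylinder hmeas _ _)) fun _ =>
      and_congr (D.smul_mem_fillEvent_iff hg hg' hpt) (smul_mem_cylinder_iff hg h)).symm

theorem measureReal_gapEvent_inter_cylinder (hm : m ∈ D.fillEvent G) :
    μ.real (D.gapEvent D.pt ∩ o.cylinder D.base m) = μ.real (o.cylinder D.dom D.ref) := by
  obtain ⟨g, hg, hg', hpt, h⟩ := D.exists_smul_ref_of_mem_fillEvent H hm
  rw [← gapEvent_pt_inter_cylinder]
  refine (measureReal_eq_of_smul_mem_iff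
    ((D.measurableSet_gapEvent hmeas _).inter (measurableSet_cylinder hmeas _ _)) fun m' =>
      and_congr ?_ (smul_mem_cylinder_iff hg h)).symm
  simpa only [hpt] using D.smul_mem_gapEvent_iff (c := D.pt) hg hg'

variable [IsFiniteMeasure μ]

theorem measureReal_fillEvent_mul_le [Countable F] :
    μ.real (D.fillEvent G) * μ.real (o.cylinder D.dom D.ref) ≤
      μ.real (D.gapEvent D.pt) * μ.real (o.realiseEvent D.base D.pt D.ref) := by
  rw [measureReal_eq_sum_restrict hmeas D.base (s := D.fillEvent G),
    measureReal_eq_sum_restrict hmeas D.base (s := D.gapEvent D.pt), Finset.sum_mul, Finset.sum_mul]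
  refine Finset.sum_le_sum fun x _ => ?_
  rcases (D.fillEvent G ∩ o.restrict D.base ⁻¹' {x}).eq_empty_or_nonempty with hx | ⟨m, hm, rfl⟩
  · rw [hx, measureReal_empty, zero_mul]
    positivity
  · rw [preimage_restrict_singleton, D.measureReal_fillEvent_inter_cylinder hmeas H hm,
      D.measureReal_gapEvent_inter_cylinder hmeas H hm, mul_comm]
    exact mul_le_mul_of_nonneg_left
      (measureReal_mono D.fillEvent_inter_cylinder_subset (measure_ne_top _ _)) measureReal_nonneg

theorem two_mul_sum_measureReal_inter_gapEvent_le {E : Finset F}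
    (hgaps : 4 ≤ #(o.gaps D.base D.pt D.ref))
    (hE : (E : Set F) ⊆ orbit (fixingSubgroup G (D.base : Set F)) D.pt)
    (hcard : 8 * #E + 1 ≤ #(o.gaps D.base D.pt D.ref)) :
    2 * ∑ p ∈ E.offDiag, μ.real (D.gapEvent p.1 ∩ D.gapEvent p.2) ≤
      #E * μ.real (D.gapEvent D.pt) := by
  rcases E.eq_empty_or_nonempty with rfl | hne
  · simp
  have hinner : 8 * (#E : ℝ) ≤ #D.inner - 1 := by
    rw [le_sub_iff_add_le]
    exact_mod_cast hcard.trans D.card_gaps_le_card_inner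
  have hpairs : (#D.inner - 1) * ∑ p ∈ E.offDiag, μ.real (D.gapEvent p.1 ∩ D.gapEvent p.2) ≤
      #E * (#E * (4 * μ.real (D.gapEvent D.pt))) := by
    rw [Finset.mul_sum, ← mul_assoc, ← Nat.cast_mul]
    refine (Finset.sum_le_card_nsmul _ _ (4 * μ.real (D.gapEvent D.pt)) fun p hp => ?_).trans ?_
    · have hp' := Finset.mem_offDiag.1 hp
      exact D.measureReal_gapEvent_inter_le hmeas H hgaps (hE hp'.1) (hE hp'.2.1) hp'.2.2
    · rw [nsmul_eq_mul]
      gcongr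
      rw [Finset.offDiag_card]
      exact Nat.sub_le _ _
  have hpos : (0 : ℝ) < 4 * #E := by
    have := Finset.card_pos.2 hne
    positivity
  refine le_of_mul_le_mul_left ?_ hpos
  calc 4 * (#E : ℝ) * (2 * ∑ p ∈ E.offDiag, μ.real (D.gapEvent p.1 ∩ D.gapEvent p.2))
      = 8 * #E * ∑ p ∈ E.offDiag, μ.real (D.gapEvent p.1 ∩ D.gapEvent p.2) := by ring
    _ ≤ (#D.inner - 1) * ∑ p ∈ E.offDiag, μ.real (D.gapEvent p.1 ∩ D.gapEvent p.2) := by gcongr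
    _ ≤ #E * (#E * (4 * μ.real (D.gapEvent D.pt))) := hpairs
    _ = 4 * #E * (#E * μ.real (D.gapEvent D.pt)) := by ring

theorem card_mul_measureReal_gapEvent_le_measureReal_fillEvent
    (hgaps : 4 ≤ #(o.gaps D.base D.pt D.ref)) (hn : 8 * n + 1 ≤ #(o.gaps D.base D.pt D.ref)) :
    n * μ.real (D.gapEvent D.pt) ≤ 2 * μ.real (D.fillEvent G) := by
  obtain ⟨E, rfl, hE⟩ := H.exists_card_eq_subset_orbit
    (by omega : n ≤ #(o.gaps D.base D.pt D.ref))
  have hunion : μ.real (⋃ c ∈ E, D.gapEvent c) ≤ μ.real (D.fillEvent G) := by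
    rw [fillEvent_eq_biUnion]
    exact measureReal_mono (Set.biUnion_subset_biUnion_left hE) (measure_ne_top _ _)
  have hbonf := sum_measureReal_sub_le_measureReal_biUnion (μ := μ) E
    (D.measurableSet_gapEvent hmeas)
  rw [Finset.sum_congr rfl fun c hc => D.measureReal_gapEvent_eq hmeas (hE hc), Finset.sum_const,
    nsmul_eq_mul] at hbonf
  have hsum := D.two_mul_sum_measureReal_inter_gapEvent_le (μ := μ) hmeas H hgaps hE hn
  linarith

end Block

variable [MeasurableSpace M] {μ : Measure M} [SMulInvariantMeasure G M μ] [IsProbabilityMeasure μ]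
  [Countable F]

namespace EquivariantOrder

theorem IsHomogeneous.measureReal_cylinder_le (H : o.IsHomogeneous)
    (hmeas : ∀ a b, MeasurableSet {m | o.lt m a b}) (hc : c ∉ A) (m₀ : M) :
    μ.real (o.cylinder A m₀) ≤ 32 * μ.real (o.realiseEvent A c m₀) := by
  rw [H.measureReal_cylinder_eq_card_gaps_mul hmeas hc]
  have hpos := H.measureReal_cylinder_pos (μ := μ) hmeas (insert c A) m₀
  rcases lt_or_ge #(o.gaps A c m₀) 9 with hgaps | hgaps
  · have hcard : (#(o.gaps A c m₀) : ℝ) ≤ 32 := by exact_mod_cast hgaps.le.trans (by norm_num)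
    exact mul_le_mul hcard (measureReal_mono cylinder_insert_subset_realiseEvent
      (measure_ne_top _ _)) measureReal_nonneg (by norm_num)
  obtain ⟨D, rfl, rfl, rfl⟩ := Block.exists_base_eq (o := o) m₀ hc (by omega)
  set k := #(o.gaps D.base D.pt D.ref)
  have hgap : 0 < μ.real (D.gapEvent D.pt) := hpos.trans_le (measureReal_mono (μ := μ)
    (D.gapEvent_pt_inter_cylinder.symm.subset.trans Set.inter_subset_left) (measure_ne_top _ _))
  have hfill := D.card_mul_measureReal_gapEvent_le_measureReal_fillEvent (μ := μ)
    (n := (k - 1) / 8) hmeas H (by omega) (by omega)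
  have hk : (k : ℝ) ≤ 16 * ((k - 1) / 8 : ℕ) := by exact_mod_cast (by omega)
  refine le_of_mul_le_mul_left ?_ hgap
  calc μ.real (D.gapEvent D.pt) * (k * μ.real (o.cylinder D.dom D.ref))
      ≤ μ.real (D.gapEvent D.pt) *
          ((16 * ((k - 1) / 8 : ℕ)) * μ.real (o.cylinder D.dom D.ref)) := by gcongr
    _ = 16 * ((((k - 1) / 8 : ℕ) * μ.real (D.gapEvent D.pt)) *
          μ.real (o.cylinder D.dom D.ref)) := by ring
    _ ≤ 16 * ((2 * μ.real (D.fillEvent G)) * μ.real (o.cylinder D.dom D.ref)) := by gcongr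
    _ = 32 * (μ.real (D.fillEvent G) * μ.real (o.cylinder D.dom D.ref)) := by ring
    _ ≤ 32 * (μ.real (D.gapEvent D.pt) * μ.real (o.realiseEvent D.base D.pt D.ref)) :=
        mul_le_mul_of_nonneg_left (D.measureReal_fillEvent_mul_le hmeas H) (by norm_num)
    _ = μ.real (D.gapEvent D.pt) * (32 * μ.real (o.realiseEvent D.base D.pt D.ref)) := by ring

end EquivariantOrder

end FillEstimate

section GenericSet

open MulAction Filter
open scoped Topology

variable {G F M : Type*} [Group G] [MulAction G F] [MulAction G M] {o : EquivariantOrder G F M}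
  {A C : Finset F} {c : F} {g : G} {m' m₀ m₁ : M}

namespace EquivariantOrder

variable (o) in
/-- The points where the one-point extension of `A` by `c` seen at `m₀` is realised, if the order on
`A` is that of `m₀`. -/
def extEvent (A : Finset F) (c : F) (m₀ : M) : Set M :=
  {m | m ∈ o.cylinder A m₀ → m ∈ o.realiseEvent A c m₀}

variable (o) in
/-- The points whose order realises every one-point extension that occurs at some point of `M`. It
plays the role of the set of points whose expansion of `F` is the Fraïssé limit of all ordered
structures occurring at points of `M`. -/
def genericSet : Set M := {m | ∀ A c m₀, m ∈ o.extEvent A c m₀}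

theorem extEvent_congr (h : AgreeOn (insert c A) (o.lt m₀) (o.lt m₁)) :
    o.extEvent A c m₀ = o.extEvent A c m₁ := by
  rw [extEvent, extEvent, realiseEvent, realiseEvent, cylinder_eq h,
    cylinder_eq (h.mono (Finset.subset_insert _ _))]

theorem compl_extEvent : (o.extEvent A c m₀)ᶜ = o.cylinder A m₀ \ o.realiseEvent A c m₀ :=
  Set.ext fun _ => Classical.not_imp

theorem genericSet_eq_iInter : o.genericSet =
    ⋂ (p : Finset F × F) (x : Set.range (o.restrict (insert p.2 p.1))),
      o.extEvent p.1 p.2 x.2.choose := by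
  ext m
  simp only [Set.mem_iInter]
  refine ⟨fun hm p x => hm _ _ _, fun hm A c m₀ => ?_⟩
  let x : Set.range (o.restrict (insert c A)) := ⟨_, m₀, rfl⟩
  rw [← extEvent_congr (restrict_eq_restrict_iff.1 x.2.choose_spec)]
  exact hm (A, c) x

theorem realiseEvent_inv_smul_subset (hAC : A ⊆ C) (hg : g ∈ fixingSubgroup G (A : Set F))
    (h : g • m' ∈ o.cylinder (insert c A) m₀) :
    o.realiseEvent C (g⁻¹ • c) m' ⊆ o.realiseEvent A c m₀ := by
  rintro m ⟨hm, k, hk, hkm⟩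
  refine ⟨?_, g * k, mul_mem hg (fixingSubgroup_antitone G F (Finset.coe_subset.2 hAC) hk), ?_⟩
  · exact ((hm.mono hAC).trans (agreeOn_smul_of_mem_fixingSubgroup hg m').symm).trans
      (cylinder_anti (Finset.subset_insert _ _) h)
  · rw [mul_smul]
    exact ((agreeOn_insert_smul_iff hg).2
      (hkm.mono (Finset.insert_subset_insert _ hAC))).trans h

namespace IsHomogeneous

variable (H : o.IsHomogeneous) [MeasurableSpace M] {μ : Measure M} [SMulInvariantMeasure G M μ]
  [IsProbabilityMeasure μ] [Countable F] (hmeas : ∀ a b, MeasurableSet {m | o.lt m a b})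
include H hmeas

theorem measureReal_compl_extEvent_inter_cylinder_le (hAC : A ⊆ C) (c : F) (m₀ m₁ : M) :
    32 * μ.real ((o.extEvent A c m₀)ᶜ ∩ o.cylinder C m₁) ≤ 31 * μ.real (o.cylinder C m₁) := by
  rw [compl_extEvent]
  rcases ((o.cylinder A m₀ \ o.realiseEvent A c m₀) ∩ o.cylinder C m₁).eq_empty_or_nonempty with
    hempty | ⟨m, hm, hmC⟩
  · rw [hempty, measureReal_empty, mul_zero]
    positivity
  obtain ⟨m', g, hg, hm', hgm'⟩ := H.amalgamation A C hAC c m m₀ hm.1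
  have hsub := realiseEvent_inv_smul_subset hAC hg hgm'
  have hc : g⁻¹ • c ∉ C := fun hc => hm.2 (hsub (cylinder_insert_subset_realiseEvent (by
    rw [Finset.insert_eq_of_mem hc]
    exact hm'.symm)))
  rw [cylinder_eq (hmC.symm.trans hm'.symm)]
  have hle := measureReal_mono (μ := μ) (show
    (o.cylinder A m₀ \ o.realiseEvent A c m₀) ∩ o.cylinder C m' ⊆
      o.cylinder C m' \ o.realiseEvent C (g⁻¹ • c) m' from
    fun z hz => ⟨hz.2, fun h => hz.1.2 (hsub h)⟩) (measure_ne_top _ _)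
  rw [measureReal_sdiff (fun _ h => h.1) (measurableSet_realiseEvent hmeas _ _ _)] at hle
  linarith [H.measureReal_cylinder_le (μ := μ) hmeas hc m']

theorem measureReal_compl_extEvent_le (hAC : A ⊆ C) {s : Set M}
    (hs : ∀ m m', AgreeOn C (o.lt m) (o.lt m') → m ∈ s → m' ∈ s)
    (hsub : (o.extEvent A c m₀)ᶜ ⊆ s) :
    32 * μ.real (o.extEvent A c m₀)ᶜ ≤ 31 * μ.real s := by
  rw [measureReal_eq_sum_restrict hmeas C, measureReal_eq_sum_restrict hmeas C (s := s),
    Finset.mul_sum, Finset.mul_sum]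
  refine Finset.sum_le_sum fun x _ => ?_
  rcases ((o.extEvent A c m₀)ᶜ ∩ o.restrict C ⁻¹' {x}).eq_empty_or_nonempty with
    hempty | ⟨m, hm, rfl⟩
  · rw [hempty, measureReal_empty, mul_zero]
    positivity
  · rw [preimage_restrict_singleton,
      Set.inter_eq_right.2 (fun m' hm' => hs m m' hm'.symm (hsub hm) : o.cylinder C m ⊆ s)]
    exact H.measureReal_compl_extEvent_inter_cylinder_le hmeas hAC c m₀ m

theorem measure_compl_extEvent (A : Finset F) (c : F) (m₀ : M) :
    μ (o.extEvent A c m₀)ᶜ = 0 := by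
  let s : Finset F → Set M := fun E => o.cylinder A m₀ \ o.realiseWithin A c m₀ E
  have hanti : Antitone s := fun E E' h => Set.sdiff_subset_sdiff_right (realiseWithin_mono h)
  have hinter : ⋂ E, s E = (o.extEvent A c m₀)ᶜ := by
    rw [compl_extEvent, ← iUnion_realiseWithin, Set.sdiff_iUnion]
  have hle : ∀ E, 32 * μ.real (o.extEvent A c m₀)ᶜ ≤ 31 * μ.real (s E) := fun E =>
    H.measureReal_compl_extEvent_le hmeas (C := E ∪ A) Finset.subset_union_right
      (fun m m' h hm => ⟨(h.symm.mono Finset.subset_union_right).trans hm.1,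
        fun hm' => hm.2 (mem_realiseWithin_of_agreeOn h.symm hm')⟩)
      (hinter.symm.subset.trans (Set.iInter_subset s E))
  have htendsto : Tendsto (fun E => μ.real (s E)) atTop (𝓝 (μ.real (o.extEvent A c m₀)ᶜ)) := by
    rw [← hinter]
    exact (ENNReal.tendsto_toReal (measure_ne_top _ _)).comp (tendsto_measure_iInter_atTop
      (fun E => ((measurableSet_cylinder hmeas A m₀).diff
        (measurableSet_realiseWithin hmeas A c m₀ E)).nullMeasurableSet)
      hanti ⟨∅, measure_ne_top _ _⟩)
  have hlim := ge_of_tendsto' (htendsto.const_mul 31) hle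
  rw [← measureReal_eq_zero_iff (measure_ne_top _ _)]
  linarith [measureReal_nonneg (μ := μ) (s := (o.extEvent A c m₀)ᶜ)]

theorem ae_mem_genericSet : ∀ᵐ m ∂μ, m ∈ o.genericSet := by
  rw [genericSet_eq_iInter]
  simp only [Set.mem_iInter, ae_all_iff]
  exact fun p x => H.measure_compl_extEvent hmeas _ _ _

end IsHomogeneous

end EquivariantOrder

end GenericSet

section Topology

open MulAction

variable {G F M : Type*} [Group G] [MulAction G F] [MulAction G M] {o : EquivariantOrder G F M}
  [TopologicalSpace M]

namespace EquivariantOrder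

variable (o) in
/-- The sets of points membership in which depends only on the order on some finite set. They form
an algebra of sets that generates the Borel sets. -/
def finitelyDetermined : Set (Set M) :=
  {s | ∃ B, ∀ m m', AgreeOn B (o.lt m) (o.lt m') → m ∈ s → m' ∈ s}

omit [TopologicalSpace M] in
theorem isPiSystem_finitelyDetermined : IsPiSystem o.finitelyDetermined := by
  rintro s ⟨B, hB⟩ t ⟨C, hC⟩ -
  exact ⟨B ∪ C, fun m m' h hm => ⟨hB m m' (h.mono Finset.subset_union_left) hm.1,
    hC m m' (h.mono Finset.subset_union_right) hm.2⟩⟩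

theorem isClopen_cylinder (hclopen : ∀ a b, IsClopen {m | o.lt m a b}) (B : Finset F) (m₀ : M) :
    IsClopen (o.cylinder B m₀) := by
  have heq : o.cylinder B m₀ = ⋂ a ∈ B, ⋂ b ∈ B, {m | o.lt m a b ↔ o.lt m₀ a b} := by
    ext m
    simp only [cylinder, AgreeOn, Set.mem_iInter, Set.mem_ofPred_eq]
  rw [heq]
  refine isClopen_biInter_finset fun a _ => isClopen_biInter_finset fun b _ => ?_
  by_cases h : o.lt m₀ a b
  · simpa only [h, iff_true] using hclopen a b
  · simpa only [h, iff_false, Set.compl_ofPred] using (hclopen a b).compl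

theorem exists_cylinder_subset [CompactSpace M] (hclopen : ∀ a b, IsClopen {m | o.lt m a b})
    (hinj : Function.Injective o.lt) {V : Set M} (hV : IsOpen V) {m : M} (hm : m ∈ V) :
    ∃ C, o.cylinder C m ⊆ V := by
  obtain ⟨C, hC⟩ := hV.isClosed_compl.isCompact.elim_directed_family_closed
    (fun C => o.cylinder C m) (fun C => (isClopen_cylinder hclopen C m).isClosed)
    (by
      refine Set.eq_empty_of_forall_notMem fun m' ⟨hm', h⟩ => hm' ?_
      rw [Set.mem_iInter] at h
      rwa [hinj (funext₂ fun a b => propext (h {a, b} a (by simp) b (by simp)) :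
        o.lt m' = o.lt m)])
    fun C C' => ⟨C ∪ C', cylinder_anti Finset.subset_union_left,
      cylinder_anti Finset.subset_union_right⟩
  exact ⟨C, Set.disjoint_compl_left_iff_subset.1 (Set.disjoint_iff_inter_eq_empty.2 hC)⟩

theorem generateFrom_finitelyDetermined [CompactSpace M] [Countable F] [MeasurableSpace M]
    [BorelSpace M] (hclopen : ∀ a b, IsClopen {m | o.lt m a b}) (hinj : Function.Injective o.lt) :
    ‹MeasurableSpace M› = MeasurableSpace.generateFrom o.finitelyDetermined := by
  refine le_antisymm ?_ (MeasurableSpace.generateFrom_le ?_)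
  · rw [‹BorelSpace M›.measurable_eq, borel]
    refine MeasurableSpace.generateFrom_le fun V (hV : IsOpen V) => ?_
    have hunion : V = ⋃ C, {m | o.cylinder C m ⊆ V} := by
      ext m
      rw [Set.mem_iUnion]
      exact ⟨exists_cylinder_subset hclopen hinj hV, fun ⟨C, hC⟩ => hC mem_cylinder_self⟩
    rw [hunion]
    refine MeasurableSet.iUnion fun C => MeasurableSpace.measurableSet_generateFrom
      ⟨C, fun m m' h hm => ?_⟩
    rwa [Set.mem_ofPred_eq, ← cylinder_eq h]
  · rintro s ⟨B, hB⟩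
    exact measurableSet_of_agreeOn (fun a b => (hclopen a b).isOpen.measurableSet) B hB

namespace IsHomogeneous

variable (H : o.IsHomogeneous)
include H

theorem measure_eq [CompactSpace M] [Countable F] [MeasurableSpace M] [BorelSpace M]
    (hclopen : ∀ a b, IsClopen {m | o.lt m a b}) (hinj : Function.Injective o.lt)
    (μ ν : Measure M) [IsProbabilityMeasure μ] [SMulInvariantMeasure G M μ]
    [IsProbabilityMeasure ν] [SMulInvariantMeasure G M ν] : μ = ν := by
  have hmeas : ∀ a b, MeasurableSet {m | o.lt m a b} := fun a b =>
    (hclopen a b).isOpen.measurableSet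
  refine ext_of_generate_finite _ (generateFrom_finitelyDetermined hclopen hinj)
    isPiSystem_finitelyDetermined ?_ (by rw [measure_univ, measure_univ])
  rintro s ⟨B, hB⟩
  rw [← measureReal_eq_measureReal_iff (measure_ne_top _ _) (measure_ne_top _ _),
    measureReal_eq_sum_restrict hmeas B, measureReal_eq_sum_restrict (μ := ν) hmeas B]
  refine Finset.sum_congr rfl fun x _ => ?_
  rcases (s ∩ o.restrict B ⁻¹' {x}).eq_empty_or_nonempty with hempty | ⟨m, hm, rfl⟩
  · rw [hempty, measureReal_empty, measureReal_empty]
  · rw [preimage_restrict_singleton,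
      Set.inter_eq_right.2 (fun m' hm' => hB m m' hm'.symm hm : o.cylinder B m ⊆ s),
      H.measureReal_cylinder hmeas, H.measureReal_cylinder hmeas]

end IsHomogeneous

section

variable (hclopen : ∀ a b, IsClopen {m | o.lt m a b})
include hclopen

theorem isOpen_realiseEvent (A : Finset F) (c : F) (m₀ : M) :
    IsOpen (o.realiseEvent A c m₀) := by
  rw [← iUnion_realiseWithin]
  refine isOpen_iUnion fun E => isOpen_iff_mem_nhds.2 fun m hm => ?_
  exact Filter.mem_of_superset ((isClopen_cylinder hclopen (E ∪ A) m).isOpen.mem_nhds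
    mem_cylinder_self) fun m' hm' => mem_realiseWithin_of_agreeOn hm'.symm hm

theorem isOpen_extEvent (A : Finset F) (c : F) (m₀ : M) : IsOpen (o.extEvent A c m₀) := by
  rw [← isClosed_compl_iff, compl_extEvent]
  exact (isClopen_cylinder hclopen A m₀).isClosed.sdiff (isOpen_realiseEvent hclopen A c m₀)

theorem isGδ_genericSet [Countable F] : IsGδ o.genericSet := by
  rw [genericSet_eq_iInter]
  exact IsGδ.iInter fun p => IsGδ.iInter fun x => (isOpen_extEvent hclopen _ _ _).isGδ

variable (H : o.IsHomogeneous) [CompactSpace M] (hinj : Function.Injective o.lt)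
include H hinj

theorem IsHomogeneous.dense_extEvent (A : Finset F) (c : F) (m₀ : M) :
    Dense (o.extEvent A c m₀) := by
  refine dense_iff_inter_open.2 fun V hV ⟨m, hm⟩ => ?_
  by_cases hA : m ∈ o.cylinder A m₀
  · obtain ⟨C, hC⟩ := exists_cylinder_subset hclopen hinj hV hm
    obtain ⟨m', g, hg, hm', hgm'⟩ :=
      H.amalgamation A (C ∪ A) Finset.subset_union_right c m m₀ hA
    exact ⟨m', hC (hm'.mono Finset.subset_union_left), fun h => ⟨h, g, hg, hgm'⟩⟩
  · exact ⟨m, hm, fun h => absurd h hA⟩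

theorem IsHomogeneous.dense_genericSet [BaireSpace M] [Countable F] : Dense o.genericSet := by
  rw [genericSet_eq_iInter]
  have hopen := isOpen_extEvent (o := o) hclopen
  exact dense_iInter_of_Gδ (fun p => IsGδ.iInter fun x => (hopen _ _ _).isGδ) fun p =>
    dense_iInter_of_isOpen (fun x => hopen _ _ _) fun x => H.dense_extEvent hclopen hinj _ _ _

end

end EquivariantOrder

end Topology

section BackAndForth

open MulAction

variable {G F M : Type*} [Group G] [MulAction G F] [MulAction G M] {o : EquivariantOrder G F M}
  {A : Finset F} {m m' : M}

variable (G F) in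
/-- The image of `G` in the group of permutations of `F` is closed for the topology of pointwise
convergence: a permutation that agrees on each finite set with an element of `G` is given by an
element of `G`. -/
def IsClosedAction : Prop :=
  ∀ e : Equiv.Perm F, (∀ A : Finset F, ∃ g : G, ∀ a ∈ A, g • a = e a) → ∃ g : G, ∀ a, g • a = e a

namespace EquivariantOrder

theorem smul_mem_genericSet (g : G) (hm : m ∈ o.genericSet) : g • m ∈ o.genericSet := by
  intro A c m₀ hA
  have hA' := (agreeOn_smul_iff (g := g⁻¹)).2 hA
  rw [inv_smul_smul] at hA'
  obtain ⟨-, k, hk, hkm⟩ := hm _ (g⁻¹ • c) _ hA'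
  refine ⟨hA, g * k * g⁻¹, (mem_fixingSubgroup_iff G).2 fun a ha => ?_, ?_⟩
  · rw [mul_smul, mul_smul,
      (mem_fixingSubgroup_iff G).1 hk _ (Finset.smul_mem_smul_finset ha), smul_inv_smul]
  · rw [mul_smul, inv_smul_smul, mul_smul]
    rwa [← Finset.smul_finset_insert, ← inv_smul_smul g (k • m), cylinder, Set.mem_ofPred_eq,
      agreeOn_smul_iff] at hkm

theorem exists_agreeOn_insert (hm' : m' ∈ o.genericSet) (h : AgreeOn A (o.lt m) (o.lt m')) (c : F) :
    ∃ g ∈ fixingSubgroup G (A : Set F), AgreeOn (insert c A) (o.lt m) (o.lt (g • m')) := by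
  obtain ⟨-, g, hg, hgm⟩ := hm' A c m h.symm
  exact ⟨g, hg, hgm.symm⟩

/-- A finite part of an isomorphism between the orders at `m` and `m'`: an element of `G` that
respects the orders on a finite set. -/
structure PartialMatch (o : EquivariantOrder G F M) (m m' : M) where
  dom : Finset F
  elt : G
  agreeOn : AgreeOn dom (o.lt m) (o.lt (elt⁻¹ • m'))

namespace PartialMatch

instance : Preorder (PartialMatch o m m') where
  le s t := s.dom ⊆ t.dom ∧ ∀ a ∈ s.dom, t.elt • a = s.elt • a
  le_refl s := ⟨subset_rfl, fun _ _ => rfl⟩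
  le_trans s t u hst htu :=
    ⟨hst.1.trans htu.1, fun a ha => (htu.2 a (hst.1 ha)).trans (hst.2 a ha)⟩

instance : Inhabited (PartialMatch o m m') := ⟨∅, 1, fun _ h => absurd h (Finset.notMem_empty _)⟩

theorem exists_le_mem (hm : m ∈ o.genericSet) (hm' : m' ∈ o.genericSet) (s : PartialMatch o m m')
    (c : F) : ∃ t : PartialMatch o m m', (c ∈ t.dom ∧ t.elt⁻¹ • c ∈ t.dom) ∧ s ≤ t := by
  obtain ⟨g, hg, hgm'⟩ := exists_agreeOn_insert (smul_mem_genericSet s.elt⁻¹ hm') s.agreeOn c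
  obtain ⟨k, hk, hkm⟩ := exists_agreeOn_insert hm hgm'.symm (g • s.elt⁻¹ • c)
  refine ⟨⟨insert (k⁻¹ • g • s.elt⁻¹ • c) (insert c s.dom), s.elt * g⁻¹ * k, ?_⟩,
    ⟨?_, ?_⟩, ?_, fun a ha => ?_⟩
  · rw [← agreeOn_insert_smul_iff hk]
    convert hkm.symm using 2
    simp only [mul_inv_rev, inv_inv, mul_smul, smul_inv_smul]
  · exact Finset.mem_insert_of_mem (Finset.mem_insert_self _ _)
  · simp only [mul_inv_rev, inv_inv, mul_smul]
    exact Finset.mem_insert_self _ _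
  · exact (Finset.subset_insert _ _).trans (Finset.subset_insert _ _)
  · have hg' := (mem_fixingSubgroup_iff G).1 (inv_mem hg) a ha
    rw [mul_smul, mul_smul, (mem_fixingSubgroup_iff G).1 hk a (Finset.mem_insert_of_mem ha), hg']

/-- The matches defined at `c` whose inverse is also defined at `c`. -/
def definedAt (hm : m ∈ o.genericSet) (hm' : m' ∈ o.genericSet) (c : F) :
    Order.Cofinal (PartialMatch o m m') where
  carrier := {t | c ∈ t.dom ∧ t.elt⁻¹ • c ∈ t.dom}
  isCofinal s := exists_le_mem hm hm' s c

theorem exists_directed [Countable F] (hm : m ∈ o.genericSet) (hm' : m' ∈ o.genericSet) :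
    ∃ s : F → PartialMatch o m m', (∀ c, c ∈ (s c).dom ∧ (s c).elt⁻¹ • c ∈ (s c).dom) ∧
      ∀ B : Finset F, ∃ t, ∀ c ∈ B, s c ≤ t := by
  have := Encodable.ofCountable F
  let I := Order.idealOfCofinals default (definedAt (o := o) hm hm')
  choose s hs hsI using Order.cofinal_meets_idealOfCofinals default (definedAt (o := o) hm hm')
  have := I.nonempty.to_subtype
  refine ⟨s, hs, fun B => ?_⟩
  obtain ⟨t, ht⟩ := I.directed.directed_val.finset_le (r := (· ≤ ·)) (B.image fun c => ⟨s c, hsI c⟩)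
  exact ⟨t, fun c hc => ht _ (Finset.mem_image_of_mem _ hc)⟩

theorem exists_perm [Countable F] (hm : m ∈ o.genericSet) (hm' : m' ∈ o.genericSet) :
    ∃ e : Equiv.Perm F, ∀ B : Finset F, ∃ t : PartialMatch o m m',
      B ⊆ t.dom ∧ ∀ a ∈ B, t.elt • a = e a := by
  obtain ⟨s, hs, hbound⟩ := exists_directed hm hm'
  have helt : ∀ {a t}, s a ≤ t → t.elt • a = (s a).elt • a := fun {a t} h => h.2 a (hs a).1
  have hinv : ∀ {d t}, s d ≤ t → t.elt⁻¹ • d = (s d).elt⁻¹ • d := fun {d t} h => by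
    rw [inv_smul_eq_iff, h.2 _ (hs d).2, smul_inv_smul]
  have hleft : ∀ a, (s ((s a).elt • a)).elt⁻¹ • (s a).elt • a = a := fun a => by
    obtain ⟨t, ht⟩ := hbound {a, (s a).elt • a}
    rw [← hinv (ht _ (by simp)), ← helt (ht a (by simp)), inv_smul_smul]
  have hright : ∀ d, (s ((s d).elt⁻¹ • d)).elt • (s d).elt⁻¹ • d = d := fun d => by
    obtain ⟨t, ht⟩ := hbound {d, (s d).elt⁻¹ • d}
    rw [← helt (ht _ (by simp)), ← hinv (ht d (by simp)), smul_inv_smul]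
  refine ⟨⟨fun a => (s a).elt • a, fun d => (s d).elt⁻¹ • d, hleft, hright⟩, fun B => ?_⟩
  obtain ⟨t, ht⟩ := hbound B
  exact ⟨t, fun a ha => (ht a ha).1 (hs a).1, fun a ha => helt (ht a ha)⟩

end PartialMatch

theorem exists_smul_eq [Countable F] (hinj : Function.Injective o.lt) (hclosed : IsClosedAction G F)
    (hm : m ∈ o.genericSet) (hm' : m' ∈ o.genericSet) : ∃ g : G, g • m' = m := by
  obtain ⟨e, he⟩ := PartialMatch.exists_perm hm hm'
  obtain ⟨g, hg⟩ := hclosed e fun A => by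
    obtain ⟨t, -, ht⟩ := he A
    exact ⟨t.elt, ht⟩
  refine ⟨g⁻¹, hinj (funext₂ fun a b => propext ?_)⟩
  obtain ⟨t, hdom, ht⟩ := he {a, b}
  calc o.lt (g⁻¹ • m') a b
      ↔ o.lt (g • g⁻¹ • m') (g • a) (g • b) := (o.smul_lt_smul_iff _ _ _ _).symm
    _ ↔ o.lt (t.elt • t.elt⁻¹ • m') (t.elt • a) (t.elt • b) := by
      rw [smul_inv_smul, smul_inv_smul, hg, hg, ht a (by simp), ht b (by simp)]
    _ ↔ o.lt (t.elt⁻¹ • m') a b := o.smul_lt_smul_iff _ _ _ _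
    _ ↔ o.lt m a b := (t.agreeOn a (hdom (by simp)) b (hdom (by simp))).symm

theorem IsHomogeneous.isDenseGδOrbit_genericSet [TopologicalSpace M] [CompactSpace M]
    [BaireSpace M] [Nonempty M] [Countable F] (H : o.IsHomogeneous)
    (hclopen : ∀ a b, IsClopen {m | o.lt m a b}) (hinj : Function.Injective o.lt)
    (hclosed : IsClosedAction G F) : IsDenseGδOrbit G o.genericSet := by
  have hdense := H.dense_genericSet hclopen hinj
  obtain ⟨m, hm⟩ := hdense.nonempty
  refine ⟨⟨m, Set.Subset.antisymm (fun m' hm' => exists_smul_eq hinj hclosed hm' hm) ?_⟩, hdense,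
    isGδ_genericSet hclopen⟩
  rintro _ ⟨g, rfl⟩
  exact smul_mem_genericSet g hm

end EquivariantOrder

theorem eq_of_isDenseGδOrbit {G X : Type*} [Group G] [TopologicalSpace X] [MulAction G X]
    [BaireSpace X] [Nonempty X] {O O' : Set X} (hO : IsDenseGδOrbit G O)
    (hO' : IsDenseGδOrbit G O') : O = O' := by
  obtain ⟨z, hz, hz'⟩ := (hO.dense.inter_of_Gδ hO.isGδ hO'.isGδ hO'.dense).nonempty
  obtain ⟨x, rfl⟩ := hO.isOrbit
  obtain ⟨y, rfl⟩ := hO'.isOrbit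
  rw [← orbit_eq_iff.2 hz, orbit_eq_iff.2 hz']

end BackAndForth

section Ramsey

open MulAction

variable {G F M : Type*} [Group G] [MulAction G F] [MulAction G M]

variable (G F) in
/-- The Ramsey property of an action: for every finite colouring of the finite subsets of `F`, all
translates of `A` inside a suitable translate of `T` have the same colour. -/
def IsRamseyAction : Prop :=
  ∀ (A T : Finset F) (k : ℕ) (χ : Finset F → Fin k), ∃ g : G, ∀ h h' : G,
    h • A ⊆ g • T → h' • A ⊆ g • T → χ (h • A) = χ (h' • A)

namespace IsRamseyAction

variable (hR : IsRamseyAction G F)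
include hR

theorem exists_common_value {κ : Type*} [Finite κ] (p : M → κ) (A T : Finset F) (m : M) :
    ∃ x : M, ∀ u u' : G, u⁻¹ • A ⊆ T → u'⁻¹ • A ⊆ T →
      ∃ h ∈ stabilizer G A, ∃ h' ∈ stabilizer G A, p (h • u • x) = p (h' • u' • x) := by
  obtain ⟨k, ⟨e⟩⟩ := Finite.exists_equiv_fin κ
  have hrep : ∀ S : Finset F, ∃ l : G, ∀ g : G, g • A = S → l • A = S := fun S => by
    by_cases h : ∃ g : G, g • A = S
    · exact h.imp fun _ hl _ _ => hl
    · exact ⟨1, fun g hg => absurd ⟨g, hg⟩ h⟩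
  choose l hl using hrep
  obtain ⟨g, hg⟩ := hR A T k fun S => e (p ((l S)⁻¹ • m))
  have hmem : ∀ u : G, (l ((g * u⁻¹) • A))⁻¹ * (g * u⁻¹) ∈ stabilizer G A := fun u => by
    rw [mem_stabilizer_iff, mul_smul _ (g * u⁻¹), inv_smul_eq_iff, hl _ (g * u⁻¹) rfl]
  refine ⟨g⁻¹ • m, fun u u' hu hu' => ⟨_, hmem u, _, hmem u', ?_⟩⟩
  have hχ := e.injective (hg (g * u⁻¹) (g * u'⁻¹)
    (by rw [mul_smul]; exact Finset.smul_finset_subset_smul_finset hu)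
    (by rw [mul_smul]; exact Finset.smul_finset_subset_smul_finset hu'))
  simpa only [mul_smul, inv_smul_smul, smul_inv_smul] using hχ

theorem exists_smul_mem_iff (V : Set M) (A T : Finset F) (m : M) :
    ∃ x : M, ∀ u u' : G, u⁻¹ • A ⊆ T → u'⁻¹ • A ⊆ T →
      ((∃ g ∈ stabilizer G A, g • u • x ∈ V) ↔ ∃ g ∈ stabilizer G A, g • u' • x ∈ V) := by
  obtain ⟨x, hx⟩ := hR.exists_common_value (fun x => ∃ g ∈ stabilizer G A, g • x ∈ V) A T m
  have hsmul : ∀ {h : G} (y : M), h ∈ stabilizer G A →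
      ((∃ g ∈ stabilizer G A, g • h • y ∈ V) ↔ ∃ g ∈ stabilizer G A, g • y ∈ V) := fun {h} y hh =>
    ⟨fun ⟨g, hg, hgV⟩ => ⟨g * h, mul_mem hg hh, by rwa [mul_smul]⟩,
      fun ⟨g, hg, hgV⟩ => ⟨g * h⁻¹, mul_mem hg (inv_mem hh), by rwa [mul_smul, inv_smul_smul]⟩⟩
  refine ⟨x, fun u u' hu hu' => ?_⟩
  obtain ⟨h, hh, h', hh', heq⟩ := hx u u' hu hu'
  rw [← hsmul (u • x) hh, ← hsmul (u' • x) hh']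
  exact iff_of_eq heq

variable [TopologicalSpace M] [CompactSpace M] [ContinuousConstSMul G M] [IsMinimal G M]

theorem exists_eq_of_isOpen {κ : Type*} [Finite κ] (p : M → κ) (A : Finset F) {V V' : Set M}
    (hV : IsOpen V) (hV' : IsOpen V') (hne : V.Nonempty) (hne' : V'.Nonempty) :
    ∃ x ∈ V, ∃ x' ∈ V', ∃ h ∈ stabilizer G A, ∃ h' ∈ stabilizer G A, p (h • x) = p (h' • x') := by
  obtain ⟨m, hm⟩ := hne
  obtain ⟨I, hI⟩ := isCompact_univ.exists_finite_cover_smul G hV ⟨m, hm⟩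
  obtain ⟨I', hI'⟩ := isCompact_univ.exists_finite_cover_smul G hV' hne'
  obtain ⟨x, hx⟩ := hR.exists_common_value p A ((I ∪ I').biUnion fun u => u • A) m
  obtain ⟨u, hu, hux⟩ := Set.mem_iUnion₂.1 (hI (Set.mem_univ x))
  obtain ⟨u', hu', hux'⟩ := Set.mem_iUnion₂.1 (hI' (Set.mem_univ x))
  refine ⟨u⁻¹ • x, Set.mem_smul_set_iff_inv_smul_mem.1 hux, u'⁻¹ • x,
    Set.mem_smul_set_iff_inv_smul_mem.1 hux', hx _ _ ?_ ?_⟩ <;> rw [inv_inv]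
  · exact Finset.subset_biUnion_of_mem (fun u => u • A) (Finset.mem_union_left _ hu)
  · exact Finset.subset_biUnion_of_mem (fun u => u • A) (Finset.mem_union_right _ hu')

variable {o : EquivariantOrder G F M} (hclopen : ∀ a b, IsClopen {m | o.lt m a b})
include hclopen

open EquivariantOrder

theorem exists_smul_mem_cylinder (B : Finset F) (m m' : M) :
    ∃ g ∈ stabilizer G B, g • m ∈ o.cylinder B m' := by
  obtain ⟨x, hx, x', hx', h, hh, h', hh', heq⟩ :=
    hR.exists_eq_of_isOpen (fun x => ∃ g ∈ stabilizer G B, g • x ∈ o.cylinder B m') B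
      (isClopen_cylinder hclopen B m).isOpen (isClopen_cylinder hclopen B m').isOpen
      ⟨m, mem_cylinder_self⟩ ⟨m', mem_cylinder_self⟩
  obtain ⟨g, hg, hgx⟩ := (iff_of_eq heq).2
    ⟨h'⁻¹, inv_mem hh', by rwa [inv_smul_smul]⟩
  refine ⟨g * h, mul_mem hg hh, ?_⟩
  rw [← mul_smul] at hgx
  exact (agreeOn_smul_of_mem_stabilizer (mul_mem hg hh) hx.symm).trans hgx

theorem isHomogeneous : o.IsHomogeneous where
  transitive := hR.exists_smul_mem_cylinder hclopen
  amalgamation A C hAC c m m' hA := by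
    obtain ⟨x, hx⟩ := hR.exists_smul_mem_iff (o.cylinder (insert c A) m') A (insert c C) m
    obtain ⟨g, hg, hgA⟩ := hR.exists_smul_mem_cylinder hclopen (insert c A) x m'
    obtain ⟨k, hk, hkC⟩ := hR.exists_smul_mem_cylinder hclopen C x m
    have hgC : g⁻¹ • A ⊆ insert c C :=
      calc g⁻¹ • A ⊆ g⁻¹ • insert c A :=
            Finset.smul_finset_subset_smul_finset (Finset.subset_insert c A)
        _ = insert c A := mem_stabilizer_iff.1 (inv_mem hg)
        _ ⊆ insert c C := Finset.insert_subset_insert c hAC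
    have hkC' : k⁻¹ • A ⊆ insert c C :=
      calc k⁻¹ • A ⊆ k⁻¹ • C := Finset.smul_finset_subset_smul_finset hAC
        _ = C := mem_stabilizer_iff.1 (inv_mem hk)
        _ ⊆ insert c C := Finset.subset_insert c C
    obtain ⟨l, hl, hlA⟩ := (hx g k hgC hkC').1 ⟨1, one_mem _, by rwa [one_smul]⟩
    refine ⟨k • x, l, mem_fixingSubgroup_of_agreeOn (o := o) (m := k • x) hl ?_, hkC, hlA⟩
    exact (hlA.mono (Finset.subset_insert c A)).trans ((hkC.mono hAC).trans hA).symm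

theorem injective_lt [T2Space M]
    (hstab : ∀ f : M → ℝ, Continuous f → ∀ ε > 0, ∃ A : Finset F,
      ∀ g ∈ fixingSubgroup G (A : Set F), ∀ m, |f (g • m) - f m| ≤ ε) :
    Function.Injective o.lt := by
  intro m₁ m₂ heq
  by_contra hne
  obtain ⟨f, hf₁, hf₂, hf⟩ := exists_continuous_zero_one_of_isClosed
    (isClosed_singleton (x := m₁)) (isClosed_singleton (x := m₂)) (Set.disjoint_singleton.2 hne)
  obtain ⟨A, hA⟩ := hstab f f.continuous (1 / 8) (by norm_num)
  choose t ht htA using fun m => hR.exists_smul_mem_cylinder hclopen A m m₁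
  -- the value of `f` at a point over `m₁` is, up to `1 / 8`, a function of its stabilizer orbit
  have hf_t : ∀ x ∈ o.cylinder A m₁, ∀ h ∈ stabilizer G A,
      |f (t (h • x) • h • x) - f x| ≤ 1 / 8 := fun x hx h hh => by
    have hth := htA (h • x)
    rw [← mul_smul] at hth ⊢
    exact hA _ (mem_fixingSubgroup_of_agreeOn (mul_mem (ht _) hh) (hth.trans hx.symm)) x
  have hfloor : ∀ x, ⌊8 * f x⌋ ∈ Finset.Icc (0 : ℤ) 8 := fun x => by
    rw [Finset.mem_Icc, Int.floor_nonneg, ← Int.lt_add_one_iff, Int.floor_lt]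
    have := hf x
    constructor <;> norm_num <;> linarith [this.1, this.2]
  have hcyl := (isClopen_cylinder hclopen A m₁).isOpen
  obtain ⟨x, ⟨hx, hfx⟩, x', ⟨hx', hfx'⟩, h, hh, h', hh', hp⟩ := hR.exists_eq_of_isOpen
    (fun x => (⟨⌊8 * f (t x • x)⌋, hfloor _⟩ : Finset.Icc (0 : ℤ) 8)) A
    (hcyl.inter (isOpen_Iio.preimage f.continuous (t := Set.Iio (1 / 8))))
    (hcyl.inter (isOpen_Ioi.preimage f.continuous (t := Set.Ioi (7 / 8))))
    ⟨m₁, mem_cylinder_self, by simp [hf₁ rfl]⟩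
    ⟨m₂, fun a _ b _ => by rw [heq], by simpa [hf₂ rfl] using by norm_num⟩
  have hlt := Int.abs_sub_lt_one_of_floor_eq_floor (congrArg Subtype.val hp)
  have hle := hf_t x hx h hh
  have hle' := hf_t x' hx' h' hh'
  rw [Set.mem_preimage, Set.mem_Iio] at hfx
  rw [Set.mem_preimage, Set.mem_Ioi] at hfx'
  rw [abs_le] at hle hle'
  rw [abs_lt] at hlt
  linarith [hle.2, hle'.1, hlt.1]

end IsRamseyAction

end Ramsey

section LinOrders

/-- The space of strict linear orders on `F`. The orders are encoded by Boolean matrices, so that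
the topology is inherited from a compact product. -/
def LinOrders (F : Type*) : Type _ :=
  {r : F → F → Bool // IsStrictTotalOrder F fun a b => r a b = true}

namespace LinOrders

variable {F : Type*} {a b : F}

/-- The order relation of a point of the space of strict linear orders. -/
def lt (r : LinOrders F) (a b : F) : Prop := r.1 a b = true

instance : TopologicalSpace (LinOrders F) := inferInstanceAs (TopologicalSpace (Subtype _))

instance : T2Space (LinOrders F) := inferInstanceAs (T2Space (Subtype _))

theorem isClopen_apply {s : Set Bool} : IsClopen {r : F → F → Bool | r a b ∈ s} :=
  (isClopen_discrete s).preimage (continuous_apply_apply a b)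

theorem isClopen_lt : IsClopen {r : LinOrders F | r.lt a b} :=
  (isClopen_apply (s := {true})).preimage continuous_subtype_val

theorem isClosed_setOf_isStrictTotalOrder :
    IsClosed {r : F → F → Bool | IsStrictTotalOrder F fun a b => r a b = true} := by
  have hc : ∀ a b, IsClopen {r : F → F → Bool | r a b = true} := fun a b =>
    isClopen_apply (s := {true})
  have hiff : ∀ r : F → F → Bool, IsStrictTotalOrder F (fun a b => r a b = true) ↔
      (∀ a, ¬r a a = true) ∧ (∀ a b c, r a b = true → r b c = true → r a c = true) ∧
        ∀ a b, ¬r a b = true → ¬r b a = true → a = b := fun r =>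
    ⟨fun h => ⟨h.irrefl, h.trans, h.trichotomous⟩,
      fun ⟨hirrefl, htrans, htri⟩ =>
        { irrefl := hirrefl, trans := htrans, trichotomous := htri }⟩
  simp only [hiff, Set.ofPred_and, Set.ofPred_forall, imp_iff_not_or, not_not, Set.ofPred_or]
  refine (isClosed_iInter fun a => (hc a a).compl.isClosed).inter
    ((isClosed_iInter fun a => isClosed_iInter fun b => isClosed_iInter fun c => ?_).inter
      (isClosed_iInter fun a => isClosed_iInter fun b => ?_))
  · exact (hc a b).compl.isClosed.union ((hc b c).compl.isClosed.union (hc a c).isClosed)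
  · exact (hc a b).isClosed.union ((hc b a).isClosed.union isClosed_const)

instance : CompactSpace (LinOrders F) :=
  isCompact_iff_compactSpace.1 isClosed_setOf_isStrictTotalOrder.isCompact

instance : Nonempty (LinOrders F) :=
  ⟨⟨fun a b => decide (WellOrderingRel a b), by
    simp only [decide_eq_true_eq]
    infer_instance⟩⟩

variable {G : Type*} [Group G] [MulAction G F]

theorem isStrictTotalOrder_smul (r : LinOrders F) (g : G) :
    IsStrictTotalOrder F fun a b => r.1 (g • a) (g • b) = true :=
  have := r.2
  (RelEmbedding.preimage ⟨(g • ·), MulAction.injective g⟩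
    fun a b => r.1 a b = true).isStrictTotalOrder

instance : MulAction G (LinOrders F) where
  smul g r := ⟨fun a b => r.1 (g⁻¹ • a) (g⁻¹ • b), isStrictTotalOrder_smul r g⁻¹⟩
  one_smul r := Subtype.ext <| funext₂ fun a b =>
    congrArg₂ r.1 (by rw [inv_one, one_smul]) (by rw [inv_one, one_smul])
  mul_smul g h r := Subtype.ext <| funext₂ fun a b =>
    congrArg₂ r.1 (by rw [mul_inv_rev, mul_smul]) (by rw [mul_inv_rev, mul_smul])

theorem smul_lt_smul_iff (g : G) (r : LinOrders F) : (g • r).lt (g • a) (g • b) ↔ r.lt a b := by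
  change r.1 (g⁻¹ • g • a) (g⁻¹ • g • b) = true ↔ r.1 a b = true
  rw [inv_smul_smul, inv_smul_smul]

theorem isFlow [TopologicalSpace G] (hG : ∀ a b : F, IsOpen {g : G | g • a = b}) :
    IsFlow G (LinOrders F) where
  compact := inferInstance
  hausdorff := inferInstance
  continuous_smul := by
    refine ⟨Continuous.subtype_mk (continuous_pi fun a => continuous_pi fun b =>
      continuous_def.2 fun s _ => ?_) _⟩
    have hunion : (fun p : G × LinOrders F => p.2.1 (p.1⁻¹ • a) (p.1⁻¹ • b)) ⁻¹' s =
        ⋃ x : F, ⋃ y : F, ({g : G | g • x = a} ∩ {g : G | g • y = b}) ×ˢ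
          {r : LinOrders F | r.1 x y ∈ s} := by
      ext ⟨g, r⟩
      simp only [Set.mem_preimage, Set.mem_iUnion, Set.mem_prod, Set.mem_inter_iff,
        Set.mem_ofPred_eq, smul_eq_iff_eq_inv_smul, and_assoc, exists_and_left, exists_eq_left]
    rw [hunion]
    exact isOpen_iUnion fun x => isOpen_iUnion fun y => ((hG x a).inter (hG y b)).prod
      (isClopen_apply.preimage continuous_subtype_val).isOpen

end LinOrders

theorem exists_equivariantOrder {G F M : Type w} [Group G] [TopologicalSpace G] [MulAction G F]
    [TopologicalSpace M] [MulAction G M] (hG : ∀ a b : F, IsOpen {g : G | g • a = b})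
    (hM : IsUniversalMinimalFlow G M) :
    ∃ o : EquivariantOrder G F M, ∀ a b, IsClopen {m | o.lt m a b} := by
  obtain ⟨Z, hZ⟩ := (LinOrders.isFlow hG).exists_minimal
  obtain ⟨π, hπ, hπG⟩ := hM.universal Z hZ
  refine ⟨⟨fun m => (π m : LinOrders F).lt, fun m => (π m : LinOrders F).2, fun g m a b => ?_⟩,
    fun a b => LinOrders.isClopen_lt.preimage (continuous_subtype_val.comp hπ)⟩
  rw [hπG, SubMulAction.val_smul]
  exact LinOrders.smul_lt_smul_iff g _

end LinOrders

section Aut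

open FirstOrder.Language MulAction

variable {L : FirstOrder.Language.{u, v}} {F : Type w} [L.Structure F]

instance autMulAction : MulAction (F ≃[L] F) F where
  smul g a := g a
  one_smul _ := rfl
  mul_smul _ _ _ := rfl

theorem isOpen_aut_smul_eq (a b : F) : IsOpen {g : F ≃[L] F | g • a = b} := by
  let _ : TopologicalSpace F := ⊥
  have : DiscreteTopology F := ⟨rfl⟩
  have heval : Continuous fun f : F → F => f a := continuous_apply a
  exact ⟨{f | f a = b}, (isOpen_discrete {b}).preimage heval, rfl⟩

theorem exists_fixingSubgroup_subset {U : Set (F ≃[L] F)} (hU : U ∈ nhds (1 : F ≃[L] F)) :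
    ∃ A : Finset F, (fixingSubgroup (F ≃[L] F) (A : Set F) : Set (F ≃[L] F)) ⊆ U := by
  let _ : TopologicalSpace F := ⊥
  have : DiscreteTopology F := ⟨rfl⟩
  rw [nhds_induced, Filter.mem_comap] at hU
  obtain ⟨V, hV, hVU⟩ := hU
  obtain ⟨W, hWV, hW, hone⟩ := mem_nhds_iff.1 hV
  obtain ⟨A, u, hu, hA⟩ := isOpen_pi_iff.1 hW _ hone
  refine ⟨A, fun g hg => hVU (hWV (hA fun a ha => ?_))⟩
  have hga : g a = a := (mem_fixingSubgroup_iff _).1 hg a ha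
  change g a ∈ u a
  rw [hga]
  exact (hu a ha).2

theorem exists_fixingSubgroup_abs_sub_le {M : Type*} [TopologicalSpace M] [CompactSpace M]
    [MulAction (F ≃[L] F) M] [ContinuousSMul (F ≃[L] F) M] (f : M → ℝ) (hf : Continuous f) (ε : ℝ)
    (hε : 0 < ε) : ∃ A : Finset F, ∀ g ∈ fixingSubgroup (F ≃[L] F) (A : Set F),
      ∀ m, |f (g • m) - f m| ≤ ε := by
  have hev : ∀ᶠ g in nhds (1 : F ≃[L] F), ∀ m ∈ (Set.univ : Set M), |f (g • m) - f m| < ε := by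
    refine isCompact_univ.eventually_forall_of_forall_eventually fun m _ => ?_
    have hc : Continuous fun z : (F ≃[L] F) × M => |f (z.1 • z.2) - f z.2| :=
      ((hf.comp continuous_smul).sub (hf.comp continuous_snd)).abs
    refine hc.continuousAt.eventually_lt continuousAt_const ?_
    simpa only [one_smul, sub_self, abs_zero] using hε
  obtain ⟨A, hA⟩ := exists_fixingSubgroup_subset hev
  exact ⟨A, fun g hg m => (hA hg m (Set.mem_univ m)).le⟩

theorem isClosedAction_aut [L.IsRelational] : IsClosedAction (F ≃[L] F) F := fun e he => by
  refine ⟨⟨e, fun φ => isEmptyElim φ, fun {n} r x => ?_⟩, fun a => rfl⟩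
  obtain ⟨g, hg⟩ := he (Finset.univ.image x)
  have hcomp : e ∘ x = g ∘ x :=
    funext fun i => (hg (x i) (Finset.mem_image_of_mem x (Finset.mem_univ i))).symm
  exact hcomp ▸ g.map_rel r x

theorem exists_ramseyArrow {K : Set (Bundled.{w} L.Structure)} (hR : IsRamsey K)
    {A B : Bundled.{w} L.Structure} (hA : A ∈ K) (hB : B ∈ K) {k : ℕ} (hk : 2 ≤ k) :
    ∃ C ∈ K, RamseyArrow L k 1 A B C := by
  have hdeg : ramseyDegreeIn K A < 2 :=
    ((le_iSup₂ (f := fun A (_ : A ∈ K) => ramseyDegreeIn K A) A hA).trans hR.le).trans_lt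
      (by norm_num)
  simp only [ramseyDegreeIn, iInf_lt_iff] at hdeg
  obtain ⟨d, hd, hd2⟩ := hdeg
  obtain ⟨C, hC, hCA⟩ := hd B hB k hk
  refine ⟨C, hC, fun χ => ?_⟩
  obtain ⟨B', hB', h⟩ := hCA χ
  exact ⟨B', hB', h.trans (Nat.lt_succ_iff.1 (mod_cast hd2))⟩

theorem exists_map_eq_map_of_mem_copies (hF : L.IsUltrahomogeneous F) {T : L.Substructure F}
    (hT : T.FG) {C : Type w} [L.Structure C] (j : C ↪[L] F) {B : L.Substructure C}
    (hB : B ∈ copies L T C) : ∃ g : F ≃[L] F, T.map g.toHom = B.map j.toHom := by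
  obtain ⟨e⟩ := hB
  obtain ⟨g, hg⟩ := hF T hT ((j.comp B.subtype).comp e.symm.toEmbedding)
  have hgj : ∀ t : T, g t = j (e.symm t) := fun t => (DFunLike.congr_fun hg t).symm
  refine ⟨g, le_antisymm ?_ ?_⟩
  · rintro _ ⟨t, ht, rfl⟩
    exact ⟨e.symm ⟨t, ht⟩, (e.symm ⟨t, ht⟩).2, (hgj ⟨t, ht⟩).symm⟩
  · rintro _ ⟨b, hb, rfl⟩
    exact ⟨e ⟨b, hb⟩, (e ⟨b, hb⟩).2, (hgj _).trans (by rw [e.symm_apply_apply]; rfl)⟩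

theorem exists_mem_copies_map_eq {C : Type w} [L.Structure C] (j : C ↪[L] F) {B : L.Substructure C}
    {S : L.Substructure F} (h : F ≃[L] F) (hle : S.map h.toHom ≤ B.map j.toHom) :
    ∃ S' ∈ copies L S C, S' ≤ B ∧ S'.map j.toHom = S.map h.toHom := by
  have hmap : ((S.map h.toHom).comap j.toHom).map j.toHom = S.map h.toHom := by
    rw [← SetLike.coe_set_eq, Substructure.coe_map, Substructure.coe_comap]
    exact Set.image_preimage_eq_of_subset fun x hx => Set.image_subset_range _ _ (hle hx)
  refine ⟨(S.map h.toHom).comap j.toHom, ⟨?_⟩, fun c hc => ?_, hmap⟩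
  · have e := j.substructureEquivMap ((S.map h.toHom).comap j.toHom)
    rw [hmap] at e
    exact (h.toEmbedding.substructureEquivMap S).symm.comp e
  · obtain ⟨b, hb, hbc⟩ := hle hc
    exact j.injective hbc ▸ hb

theorem coe_map_closure [L.IsRelational] (h : F ≃[L] F) (A : Finset F) :
    ((Substructure.closure L (A : Set F)).map h.toHom : Set F) = (h • A : Finset F) := by
  rw [Substructure.coe_map, Substructure.closure_eq_of_isRelational, Finset.coe_smul_finset]
  rfl

theorem isRamseyAction_aut [L.IsRelational] (hF : L.IsUltrahomogeneous F)
    (hR : IsRamsey (L.age F)) : IsRamseyAction (F ≃[L] F) F := fun A T k χ => by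
  have hfg : ∀ S : Finset F, (Substructure.closure L (S : Set F)).FG := fun S =>
    Substructure.fg_closure S.finite_toSet
  obtain ⟨C, ⟨-, ⟨j⟩⟩, hC⟩ := exists_ramseyArrow hR (age.fg_substructure (hfg A))
    (age.fg_substructure (hfg T)) (Nat.le_add_left 2 k)
  -- `χ` extended to a colouring of all subsets of `F`
  let ψ : Set F → Fin (k + 2) := Function.extend (↑) (fun S : Finset F => Fin.castAdd 2 (χ S)) 0
  have hψ : ∀ S : Finset F, ψ S = Fin.castAdd 2 (χ S) :=
    Finset.coe_injective.extend_apply _ _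
  obtain ⟨B, hB, hcard⟩ := hC fun S => ψ (S.1.map j.toHom : L.Substructure F)
  obtain ⟨g, hg⟩ := exists_map_eq_map_of_mem_copies hF (hfg T) j hB
  have hcopy : ∀ h : F ≃[L] F, h • A ⊆ g • T → Fin.castAdd 2 (χ (h • A)) ∈
      (fun S : copies L (Substructure.closure L (A : Set F)) C =>
        ψ (S.1.map j.toHom : L.Substructure F)) '' {S | S.1 ≤ B} := fun h hh => by
    obtain ⟨S, hS, hSB, hSA⟩ := exists_mem_copies_map_eq j h
      (S := Substructure.closure L (A : Set F)) (B := B) (by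
        rw [← hg, ← SetLike.coe_subset_coe, coe_map_closure, coe_map_closure]
        exact Finset.coe_subset.2 hh)
    refine ⟨⟨S, hS⟩, hSB, ?_⟩
    beta_reduce
    rw [hSA, coe_map_closure, hψ]
  exact ⟨g, fun h h' hh hh' => Fin.castAdd_injective _ _
    ((Set.ncard_le_one (Set.toFinite _)).1 hcard _ (hcopy h hh) _ (hcopy h' hh'))⟩

end Aut

end

end OrderFlow

theorem theorem4p1_general {L : FirstOrder.Language.{u, v}} [L.IsRelational] (F : Type w)
    [L.Structure F] [Countable F] (hF : L.IsUltrahomogeneous F) (hR : IsRamsey (L.age F))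
    (M : Type w) [TopologicalSpace M] [MeasurableSpace M] [BorelSpace M] [MulAction (F ≃[L] F) M]
    (hM : IsUniversalMinimalFlow (F ≃[L] F) M)
    (hA : ∃ μ : Measure M, IsInvariantProbability (F ≃[L] F) μ) :
    (∃! μ : Measure M, IsInvariantProbability (F ≃[L] F) μ) ∧
      (∃! O : Set M, IsDenseGδOrbit (F ≃[L] F) O) ∧
      ∀ (μ : Measure M) (O : Set M), IsInvariantProbability (F ≃[L] F) μ →
        IsDenseGδOrbit (F ≃[L] F) O → μ O = 1 := by
  obtain ⟨⟨⟨_, _, _⟩, _, _⟩, -⟩ := id hM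
  have hRam := OrderFlow.isRamseyAction_aut hF hR
  obtain ⟨o, hclopen⟩ := OrderFlow.exists_equivariantOrder OrderFlow.isOpen_aut_smul_eq hM
  have H := hRam.isHomogeneous hclopen
  have hinj := hRam.injective_lt hclopen OrderFlow.exists_fixingSubgroup_abs_sub_le
  have hO := H.isDenseGδOrbit_genericSet hclopen hinj OrderFlow.isClosedAction_aut
  refine ⟨?_, ⟨_, hO, fun O hO' => OrderFlow.eq_of_isDenseGδOrbit hO' hO⟩, ?_⟩
  · obtain ⟨μ, hμ⟩ := hA
    refine ⟨μ, hμ, fun ν hν => ?_⟩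
    obtain ⟨⟨_, _⟩, ⟨_, _⟩⟩ := And.intro hμ hν
    exact H.measure_eq hclopen hinj ν μ
  · rintro μ O ⟨_, _⟩ hO'
    rw [OrderFlow.eq_of_isDenseGδOrbit hO' hO, ← mem_ae_iff_prob_eq_one hO.isGδ.measurableSet]
    exact H.ae_mem_genericSet fun a b => (hclopen a b).isOpen.measurableSet

theorem theorem4p1 {L : FirstOrder.Language.{u, v}} [L.IsRelational] [Countable L.Symbols]
    (K : Set (Bundled.{w} L.Structure)) (hK : IsFraisseClass K) (hR : IsRamsey K)
    (F : Type w) [L.Structure F] [Countable F] (hF : FirstOrder.Language.IsFraisseLimit K F)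
    (M : Type w) [TopologicalSpace M] [MeasurableSpace M] [BorelSpace M] [MulAction (F ≃[L] F) M]
    (hM : IsUniversalMinimalFlow (F ≃[L] F) M)
    (hA : ∃ μ : Measure M, IsInvariantProbability (F ≃[L] F) μ) :
    (∃! μ : Measure M, IsInvariantProbability (F ≃[L] F) μ) ∧
      (∃! O : Set M, IsDenseGδOrbit (F ≃[L] F) O) ∧
      ∀ (μ : Measure M) (O : Set M), IsInvariantProbability (F ≃[L] F) μ →
        IsDenseGδOrbit (F ≃[L] F) O → μ O = 1 :=
  theorem4p1_general F hF.ultrahomogeneous (hF.age ▸ hR) M hM hA
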